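/- Let $H=\sum_{a=1}^{L}H_a$ be a $k$-local Hamiltonian on $n$ qubits: each term $H_a$ is Hermitian and acts non-trivially on at most $k$ qubits. Assume that $H$ is stoquastic (every $H_a$ has real non-positive off-diagonal entries in the computational basis) and frustration free (a ground state of $H$ is simultaneously a ground state of each $H_a$), that $H$ has an energy gap at least $\Delta>0$ above its (possibly degenerate) ground energy, and that $\|H_a\|_{\mathrm{op}}\le J$ for all $a$. Let $\Pi$ be the orthogonal projection onto the ground subspace of $H$, let $|+\rangle=2^{-n/2}\sum_{x\in\{0,1\}^n}|x\rangle$ be the uniform superposition, and let $\eta=\sqrt{\langle +|\Pi|+\rangle}$. Then $\eta>0$ and $\log(\eta^{-1})\le \frac n2\log 2$. A Hyper Boltzmann Machine (HBM) with $n$ visible and $m$ hidden nodes consists of a finite set $E$ of subsets (hyperedges) of the set of nodes and, for each $e\in E$, a real-valued energy function $F_e$ of the bits carried by the nodes in $e$. Its output is $f(x)=\sum_{h\in\{0,1\}^m}\exp\bigl(-\sum_{e\in E}F_e(x,h)\bigr)$ for $x\in\{0,1\}^n$. It is $\ell$-local if every hyperedge contains at most $\ell$ nodes. It represents a state $|\psi\rangle$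 to precision $\epsilon$ in distribution if $\frac12\sum_x\bigl|\frac{f(x)}{\sum_y f(y)}-|\langle x|\psi\rangle|^2\bigr|\le\epsilon$. For every $0<\epsilon\le 1$, the ground state $|\psi_0\rangle=\frac1\eta\Pi|+\rangle$ of $H$ is represented to precision $\epsilon$ in distribution by a $2k$-local HBM with $O\bigl(kL^3J\Delta^{-1}\log(\eta^{-1}\epsilon^{-1})\bigr)$ hidden nodes and $O\bigl(L^3J\Delta^{-1}\log(\eta^{-1}\epsilon^{-1})\bigr)$ hyperedges, in which each node is contained in at most $2$ hyperedges. The constants implied by $O(\cdot)$ are absolute. -/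

import Mathlib

open scoped BigOperators

/-- The Hilbert space of `n` qubits; the standard basis is indexed by bit strings. -/
abbrev QubitSpace (n : ℕ) : Type := EuclideanSpace ℂ (Fin n → Bool)

/-- Operators on `n` qubits, as matrices in the computational basis: `A x y = ⟨x|A|y⟩`. -/
abbrev QubitMatrix (n : ℕ) : Type := Matrix (Fin n → Bool) (Fin n → Bool) ℂ

/-- `A` acts non-trivially only on the qubits in `S`: it is `h ⊗ 1`, with `h` an operator on the
qubits in `S` and `1` the identity on the other qubits. -/
def ActsOn {n : ℕ} (A : QubitMatrix n) (S : Finset (Fin n)) : Prop :=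
  ∃ h : Matrix (S → Bool) (S → Bool) ℂ, ∀ x y : Fin n → Bool,
    A x y = if (∀ i, i ∉ S → x i = y i) then h (fun i => x i) (fun i => y i) else 0

/-- Operator norm with respect to the Hilbert space norm. -/
noncomputable def opNorm {n : ℕ} (A : QubitMatrix n) : ℝ :=
  ‖Matrix.toEuclideanCLM (n := Fin n → Bool) (𝕜 := ℂ) A‖

/-- The smallest (real) eigenvalue of a Hermitian operator. -/
noncomputable def groundEnergy {n : ℕ} (A : QubitMatrix n) : ℝ :=
  sInf (spectrum ℝ A)

/-- The ground subspace: the eigenspace of the smallest eigenvalue. -/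
noncomputable def groundSpace {n : ℕ} (A : QubitMatrix n) : Submodule ℂ (QubitSpace n) :=
  Module.End.eigenspace (Matrix.toEuclideanLin A) (groundEnergy A : ℂ)

/-- The spectrum of `A` has a gap (of at least) `Δ` above the ground energy. The ground energy may
be degenerate. -/
def HasEnergyGap {n : ℕ} (A : QubitMatrix n) (Δ : ℝ) : Prop :=
  0 < Δ ∧ ∀ μ ∈ spectrum ℝ A, μ ≠ groundEnergy A → groundEnergy A + Δ ≤ μ

/-- The uniform superposition `|+⟩` on `n` qubits. -/
noncomputable def plusState (n : ℕ) : QubitSpace n :=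
  WithLp.toLp 2 (fun _ => (((Real.sqrt (2 ^ n))⁻¹ : ℝ) : ℂ))

/-- The overlap `η = √⟨+|Π|+⟩`, where `Π` is the projection onto the ground subspace of `A`. -/
noncomputable def plusOverlap {n : ℕ} (A : QubitMatrix n) : ℝ :=
  Real.sqrt (inner ℂ (plusState n) ((groundSpace A).starProjection (plusState n))).re

/-- The state `|ψ₀⟩ = η⁻¹ Π |+⟩`. -/
noncomputable def plusGroundState {n : ℕ} (A : QubitMatrix n) : QubitSpace n :=
  (((plusOverlap A)⁻¹ : ℝ) : ℂ) • (groundSpace A).starProjection (plusState n)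

/-- A `k`-local Hamiltonian on `n` qubits with `L` terms: a family of Hermitian operators, each
acting non-trivially on at most `k` qubits. -/
structure LocalHamiltonian (n k L : ℕ) where
  term : Fin L → QubitMatrix n
  hermitian : ∀ a, (term a).IsHermitian
  isLocal : ∀ a, ∃ S : Finset (Fin n), S.card ≤ k ∧ ActsOn (term a) S

namespace LocalHamiltonian

variable {n k L : ℕ}

/-- The Hamiltonian `H = ∑ₐ Hₐ`. -/
noncomputable def total (H : LocalHamiltonian n k L) : QubitMatrix n := ∑ a, H.term a

/-- Every term has real non-positive off-diagonal entries in the computational basis. -/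
def IsStoquastic (H : LocalHamiltonian n k L) : Prop :=
  ∀ a x y, x ≠ y → (H.term a x y).im = 0 ∧ (H.term a x y).re ≤ 0

/-- A ground state of `H` is simultaneously a ground state of each term. (If this holds for one
ground state of `H`, it holds for all of them.) -/
def IsFrustrationFree (H : LocalHamiltonian n k L) : Prop :=
  ∃ ψ : QubitSpace n, ψ ≠ 0 ∧ ψ ∈ groundSpace H.total ∧ ∀ a, ψ ∈ groundSpace (H.term a)

end LocalHamiltonian

/-- A Hyper Boltzmann Machine with `n` visible nodes and `m` hidden nodes: a hypergraph on the
nodes with a local energy term for each hyperedge, depending on the bits of the nodes in the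
hyperedge. (Values of `energy` at sets that are not hyperedges are never used.) -/
structure HBM (n m : ℕ) where
  edges : Finset (Finset (Fin n ⊕ Fin m))
  energy : (e : Finset (Fin n ⊕ Fin m)) → (e → Bool) → ℝ

namespace HBM

variable {n m : ℕ}

/-- The total energy `F = ∑ₑ Fₑ` of a configuration of all the nodes. -/
noncomputable def totalEnergy (B : HBM n m) (y : Fin n ⊕ Fin m → Bool) : ℝ :=
  ∑ e ∈ B.edges, B.energy e (fun v => y v)

/-- The output `f(x) = ∑ₕ exp(-F(x,h))`. -/
noncomputable def output (B : HBM n m) (x : Fin n → Bool) : ℝ :=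
  ∑ h : Fin m → Bool, Real.exp (-B.totalEnergy (Sum.elim x h))

/-- Every hyperedge contains at most `k` nodes. -/
def IsLocal (B : HBM n m) (k : ℕ) : Prop := ∀ e ∈ B.edges, e.card ≤ k

/-- The number of hyperedges that contain the node `v`. -/
def degree (B : HBM n m) (v : Fin n ⊕ Fin m) : ℕ := (B.edges.filter (fun e => v ∈ e)).card

/-- `B` represents the state `ψ` to precision `ε` in distribution: the total variation distance
between `f(x) / ∑ᵧ f(y)` and `|⟨x|ψ⟩|²` is at most `ε`. -/
def RepresentsInDistribution (B : HBM n m) (ψ : QubitSpace n) (ε : ℝ) : Prop :=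
  (1 / 2 : ℝ) * ∑ x : Fin n → Bool, |B.output x / (∑ y, B.output y) - ‖ψ x‖ ^ 2| ≤ ε

end HBM

/-! Put τ = 1/(2J) and let Eₐ be the ground energy of Hₐ. The gate 1 - τ(Hₐ - Eₐ) is a positive
contraction with non-negative entries: stoquasticity gives the off-diagonal ones, positivity the
diagonal ones. By frustration freeness it fixes the ground space of H pointwise, hence preserves the
orthogonal complement.

Apply the gates to |+⟩, cyclically through the terms. The component Π|+⟩ stays put. On the
complement, one round multiplies the squared norm by at most exp(-τΔ/(4L²)) (`norm_dampSeq_sq_le`):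
if a round lost little norm, the vector would hardly move during it, so every Hₐ - Eₐ would have
small expectation in the initial vector, against the gap. Hence about JL²Δ⁻¹ log(η⁻¹ε⁻¹) rounds of L
gates suffice.

The resulting amplitudes are, up to a constant, the output of a network
(`exists_hyperNetwork_dampSeq`). A gate on S turns the visible nodes in S into hidden ones and adds
a hyperedge joining them to fresh visible nodes. Visible nodes then lie in at most one hyperedge and
hidden ones in at most two. Probabilities are squared amplitudes, so two copies are glued along the
visible nodes (`square`), which brings visible degrees up to at most two. Weights may vanish whereas
Boltzmann weights cannot; a strict error bound leaves room to add a small constant (`exists_hbm`).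

That η > 0 is a Perron–Frobenius argument: entrywise absolute values of a ground state form a ground
state, whose overlap with |+⟩ is at least 2^(-n/2) (`inv_sqrt_le_plusOverlap`). -/

/-! ### Networks with non-negative weights, gates, squaring, and passage to HBMs -/

/-- A hypergraph on `n` visible nodes and finitely many hidden nodes, with a non-negative weight
for each hyperedge that depends only on the bits of the nodes in the hyperedge. -/
structure HyperNetwork (n : ℕ) where
  Hidden : Type
  Index : Type
  [fintypeHidden : Fintype Hidden]
  [decEqHidden : DecidableEq Hidden]
  [fintypeIndex : Fintype Index]
  edge : Index → Finset (Fin n ⊕ Hidden)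
  weight : Index → (Fin n ⊕ Hidden → Bool) → ℝ
  weight_nonneg : ∀ t y, 0 ≤ weight t y
  weight_congr : ∀ t y z, (∀ v ∈ edge t, y v = z v) → weight t y = weight t z
  edge_injective : Function.Injective edge
  -- The hyperedges of an HBM form a set; this condition keeps those of the two copies in `square`
  -- distinct.
  exists_hidden : ∀ t, ∃ j, Sum.inr j ∈ edge t

namespace HyperNetwork

attribute [instance] fintypeHidden decEqHidden fintypeIndex

variable {n : ℕ}

/-- The sum over the hidden nodes of the product of the weights. -/
noncomputable def output (N : HyperNetwork n) (x : Fin n → Bool) : ℝ :=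
  ∑ h : N.Hidden → Bool, ∏ t, N.weight t (Sum.elim x h)

/-- The number of hyperedges that contain the node `v`. -/
def degree (N : HyperNetwork n) (v : Fin n ⊕ N.Hidden) : ℕ :=
  (Finset.univ.filter (fun t => v ∈ N.edge t)).card

/-- The network without hidden nodes and hyperedges. -/
def empty (n : ℕ) : HyperNetwork n where
  Hidden := Empty
  Index := Empty
  edge := Empty.elim
  weight := fun t => t.elim
  weight_nonneg := fun t => t.elim
  weight_congr := fun t => t.elim
  edge_injective := fun t => t.elim
  exists_hidden := fun t => t.elim

theorem empty_output (x : Fin n → Bool) : (empty n).output x = 1 := by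
  have : IsEmpty (empty n).Hidden := inferInstanceAs (IsEmpty Empty)
  have : IsEmpty (empty n).Index := inferInstanceAs (IsEmpty Empty)
  simp [output]

/-- Replace the bits of `x` in `S` by those of `z`. -/
def overwrite {S : Finset (Fin n)} (x : Fin n → Bool) (z : S → Bool) : Fin n → Bool :=
  fun i => if h : i ∈ S then z ⟨i, h⟩ else x i

/-- Turn the visible nodes in `S` into new hidden nodes. -/
def hideMap (S : Finset (Fin n)) (K : Type) : Fin n ⊕ K → Fin n ⊕ (K ⊕ S) :=
  Sum.elim (fun i => if h : i ∈ S then Sum.inr (Sum.inr ⟨i, h⟩) else Sum.inl i)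
    (fun j => Sum.inr (Sum.inl j))

theorem hideMap_injective (S : Finset (Fin n)) (K : Type) :
    Function.Injective (hideMap S K) := by
  rintro (i | i) (j | j) h
  · simp only [hideMap, Sum.elim_inl] at h
    split_ifs at h <;> simp_all
  · simp only [hideMap, Sum.elim_inl, Sum.elim_inr] at h
    split_ifs at h
    simp_all
  · simp only [hideMap, Sum.elim_inl, Sum.elim_inr] at h
    split_ifs at h
    simp_all
  · simpa [hideMap] using h

theorem hideMap_ne_inl {S : Finset (Fin n)} {K : Type} {i : Fin n} (hi : i ∈ S) (v : Fin n ⊕ K) :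
    hideMap S K v ≠ Sum.inl i := by
  rcases v with j | j
  · simp only [hideMap, Sum.elim_inl]
    split_ifs with h
    · simp
    · rintro h'
      exact h (by simpa [Sum.inl.inj h'] using hi)
  · simp [hideMap]

/-- The hyperedge of a gate on `S`: the visible nodes in `S` and their new hidden copies. -/
def gateEdge (S : Finset (Fin n)) (K : Type) : Finset (Fin n ⊕ (K ⊕ S)) :=
  (S.map ⟨Sum.inl, Sum.inl_injective⟩).disjUnion
    ((Finset.univ : Finset S).map ⟨fun i => Sum.inr (Sum.inr i), fun i j h => by simpa using h⟩)
    (by simp [Finset.disjoint_left])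

theorem inl_mem_gateEdge {S : Finset (Fin n)} {K : Type} {i : Fin n} :
    (Sum.inl i : Fin n ⊕ (K ⊕ S)) ∈ gateEdge S K ↔ i ∈ S := by
  simp [gateEdge]

theorem inr_inr_mem_gateEdge {S : Finset (Fin n)} {K : Type} (i : S) :
    (Sum.inr (Sum.inr i) : Fin n ⊕ (K ⊕ S)) ∈ gateEdge S K :=
  Finset.mem_disjUnion.2 (.inr (Finset.mem_map.2 ⟨i, Finset.mem_univ _, rfl⟩))

theorem inr_inl_notMem_gateEdge {S : Finset (Fin n)} {K : Type} (j : K) :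
    (Sum.inr (Sum.inl j) : Fin n ⊕ (K ⊕ S)) ∉ gateEdge S K := by
  intro h
  rcases Finset.mem_disjUnion.1 h with h | h <;> obtain ⟨i, -, hi⟩ := Finset.mem_map.1 h
  · exact Sum.inl_ne_inr hi
  · exact Sum.inr_ne_inl (Sum.inr.inj hi)

theorem card_gateEdge (S : Finset (Fin n)) (K : Type) : (gateEdge S K).card = 2 * S.card := by
  simp [gateEdge, two_mul]

/-- Apply a gate with matrix `w` on the qubits in `S` to the output of a network. -/
abbrev applyGate (N : HyperNetwork n) (S : Finset (Fin n)) (hS : S.Nonempty)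
    (w : (S → Bool) → (S → Bool) → ℝ) (hw : ∀ u z, 0 ≤ w u z) : HyperNetwork n where
  Hidden := N.Hidden ⊕ S
  Index := Option N.Index
  edge := fun t => t.elim (gateEdge S N.Hidden)
    (fun t => (N.edge t).map ⟨_, hideMap_injective S N.Hidden⟩)
  weight := fun t => t.elim
    (fun y => w (fun i => y (Sum.inl i)) (fun i => y (Sum.inr (Sum.inr i))))
    (fun t y => N.weight t (y ∘ hideMap S N.Hidden))
  weight_nonneg := by
    rintro (_ | t) y
    · exact hw _ _
    · exact N.weight_nonneg _ _
  weight_congr := by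
    rintro (_ | t) y z h
    · have h1 : (fun i : S => y (Sum.inl i)) = fun i : S => z (Sum.inl i) :=
        funext fun i => h _ (inl_mem_gateEdge.2 i.2)
      have h2 : (fun i : S => y (Sum.inr (Sum.inr i))) = fun i : S => z (Sum.inr (Sum.inr i)) :=
        funext fun i => h _ (inr_inr_mem_gateEdge i)
      simp only [Option.elim, h1, h2]
    · exact N.weight_congr t _ _ fun v hv => h _ (Finset.mem_map_of_mem _ hv)
  edge_injective := by
    obtain ⟨i, hi⟩ := hS
    have key : ∀ t, gateEdge S N.Hidden ≠
        (N.edge t).map ⟨_, hideMap_injective S N.Hidden⟩ := by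
      intro t h
      have := inl_mem_gateEdge (K := N.Hidden).2 hi
      rw [h, Finset.mem_map] at this
      obtain ⟨v, -, hv⟩ := this
      exact hideMap_ne_inl hi v hv
    rintro (_ | s) (_ | t) h
    · rfl
    · exact absurd h (key t)
    · exact absurd h.symm (key s)
    · exact congrArg some (N.edge_injective (Finset.map_injective _ h))
  exists_hidden := by
    obtain ⟨i, hi⟩ := hS
    rintro (_ | t)
    · exact ⟨_, inr_inr_mem_gateEdge ⟨i, hi⟩⟩
    · obtain ⟨j, hj⟩ := N.exists_hidden t
      exact ⟨_, Finset.mem_map_of_mem _ hj⟩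

section applyGate

variable (N : HyperNetwork n) {S : Finset (Fin n)} (hS : S.Nonempty)
  {w : (S → Bool) → (S → Bool) → ℝ} (hw : ∀ u z, 0 ≤ w u z)

theorem elim_comp_hideMap {K : Type} (x : Fin n → Bool) (h : K ⊕ S → Bool) :
    (Sum.elim x h : Fin n ⊕ (K ⊕ S) → Bool) ∘ hideMap S K =
      Sum.elim (overwrite x (fun i => h (Sum.inr i))) fun j => h (Sum.inl j) := by
  funext v
  rcases v with i | j
  · simp only [Function.comp, hideMap, Sum.elim_inl, overwrite]
    split_ifs <;> simp
  · simp [hideMap]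

/-- The bits of the new hidden nodes are the summation index of the matrix-vector product: the old
network sees them in place of `x` on `S`. -/
theorem applyGate_output (x : Fin n → Bool) :
    (N.applyGate S hS w hw).output x =
      ∑ z : S → Bool, w (fun i => x i) z * N.output (overwrite x z) := by
  have h1 : (N.applyGate S hS w hw).output x = ∑ h : N.Hidden ⊕ S → Bool,
      w (fun i => x i) (fun i => h (Sum.inr i)) *
        ∏ t, N.weight t (Sum.elim (overwrite x (fun i => h (Sum.inr i))) fun j => h (Sum.inl j)) := by
    refine Finset.sum_congr rfl fun h _ => ?_
    refine (Fintype.prod_option _).trans ?_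
    refine congrArg₂ _ rfl (Finset.prod_congr rfl fun t _ => congrArg (N.weight t) ?_)
    exact elim_comp_hideMap x h
  rw [h1, ← (Equiv.sumArrowEquivProdArrow N.Hidden S Bool).symm.sum_comp, Fintype.sum_prod_type_right]
  simp [output, Finset.mul_sum, Equiv.sumArrowEquivProdArrow]

theorem applyGate_card_index :
    Fintype.card (N.applyGate S hS w hw).Index = Fintype.card N.Index + 1 :=
  Fintype.card_option

theorem applyGate_card_hidden :
    Fintype.card (N.applyGate S hS w hw).Hidden = Fintype.card N.Hidden + S.card := by
  refine (Fintype.card_sum (α := N.Hidden) (β := S)).trans ?_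
  simp

theorem applyGate_card_edge {k : ℕ} (hk : S.card ≤ k) (hN : ∀ t, (N.edge t).card ≤ 2 * k) (t) :
    ((N.applyGate S hS w hw).edge t).card ≤ 2 * k := by
  rcases t with _ | t
  · exact (card_gateEdge S N.Hidden).le.trans (by omega)
  · exact (Finset.card_map _).le.trans (hN t)

theorem applyGate_degree (v : Fin n ⊕ (N.Hidden ⊕ S)) :
    (N.applyGate S hS w hw).degree v = (if v ∈ gateEdge S N.Hidden then 1 else 0) +
      (Finset.univ.filter (fun t => v ∈
        (N.edge t).map ⟨_, hideMap_injective S N.Hidden⟩)).card := by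
  have : (N.applyGate S hS w hw).degree v = ∑ t : Option N.Index,
      if v ∈ (N.applyGate S hS w hw).edge t then 1 else 0 := Finset.card_filter _ _
  rw [this, Fintype.sum_option, Finset.card_filter]
  rfl

theorem card_filter_hideMap (v : Fin n ⊕ N.Hidden) :
    (Finset.univ.filter (fun t => hideMap S N.Hidden v ∈
        (N.edge t).map ⟨_, hideMap_injective S N.Hidden⟩)).card = N.degree v := by
  refine congrArg Finset.card (Finset.filter_congr fun t _ => ?_)
  exact Finset.mem_map' ⟨_, hideMap_injective S N.Hidden⟩

/-- Old hyperedges have been moved off the visible nodes in `S`, which meet only the new gate;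
elsewhere nothing changes. -/
theorem applyGate_degree_visible (hN : ∀ i, N.degree (Sum.inl i) ≤ 1) (i : Fin n) :
    (N.applyGate S hS w hw).degree (Sum.inl i) ≤ 1 := by
  refine (N.applyGate_degree hS hw (Sum.inl i)).le.trans ?_
  by_cases hi : i ∈ S
  · rw [if_pos (inl_mem_gateEdge.2 hi), Finset.card_eq_zero.2]
    simp only [Finset.filter_eq_empty_iff, Finset.mem_map, not_exists, not_and]
    exact fun t _ v _ => hideMap_ne_inl hi v
  · have h := N.card_filter_hideMap (S := S) (Sum.inl i)
    simp only [hideMap, Sum.elim_inl, dif_neg hi] at h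
    rw [if_neg (fun h' => hi (inl_mem_gateEdge.1 h'))]
    erw [h]
    simpa using hN i

/-- A new hidden node inherits the at most one hyperedge of the visible node it replaces and gains
the gate; later gates never touch it. -/
theorem applyGate_degree_hidden (hN : ∀ i, N.degree (Sum.inl i) ≤ 1)
    (hN' : ∀ j, N.degree (Sum.inr j) ≤ 2) (j) :
    (N.applyGate S hS w hw).degree (Sum.inr j) ≤ 2 := by
  refine (N.applyGate_degree hS hw (Sum.inr j)).le.trans ?_
  rcases j with j | ⟨i, hi⟩
  · have h := N.card_filter_hideMap (S := S) (Sum.inr j)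
    simp only [hideMap, Sum.elim_inr] at h
    rw [if_neg (inr_inl_notMem_gateEdge j)]
    erw [h]
    simpa using hN' j
  · have h := N.card_filter_hideMap (S := S) (Sum.inl i)
    simp only [hideMap, Sum.elim_inl, dif_pos hi] at h
    rw [if_pos (inr_inr_mem_gateEdge _)]
    erw [h]
    have := hN i
    omega

end applyGate

/-- The network with two copies of the hidden nodes and hyperedges; its output is the square of
the output of the network. -/
abbrev square (N : HyperNetwork n) : HyperNetwork n where
  Hidden := N.Hidden ⊕ N.Hidden
  Index := N.Index ⊕ N.Index
  edge := Sum.elim (fun t => (N.edge t).map ((Function.Embedding.refl _).sumMap .inl))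
    (fun t => (N.edge t).map ((Function.Embedding.refl _).sumMap .inr))
  weight := Sum.elim (fun t y => N.weight t (y ∘ Sum.map id Sum.inl))
    (fun t y => N.weight t (y ∘ Sum.map id Sum.inr))
  weight_nonneg := by
    rintro (t | t) y <;> exact N.weight_nonneg _ _
  weight_congr := by
    rintro (t | t) y z h <;>
      exact N.weight_congr t _ _ fun v hv => h _ (Finset.mem_map_of_mem _ hv)
  edge_injective := by
    have key : ∀ s t, (N.edge s).map ((Function.Embedding.refl (Fin n)).sumMap .inl) ≠
        (N.edge t).map ((Function.Embedding.refl (Fin n)).sumMap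
          (.inr : N.Hidden ↪ N.Hidden ⊕ N.Hidden)) := by
      intro s t h
      obtain ⟨j, hj⟩ := N.exists_hidden s
      have := Finset.mem_map_of_mem ((Function.Embedding.refl (Fin n)).sumMap
        (.inl : N.Hidden ↪ N.Hidden ⊕ N.Hidden)) hj
      rw [h, Finset.mem_map] at this
      obtain ⟨v | v, -, hv⟩ := this <;> simp at hv
    rintro (s | s) (t | t) h
    · exact congrArg _ (N.edge_injective (Finset.map_injective _ h))
    · exact absurd h (key s t)
    · exact absurd h.symm (key t s)
    · exact congrArg _ (N.edge_injective (Finset.map_injective _ h))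
  exists_hidden := by
    rintro (t | t) <;> obtain ⟨j, hj⟩ := N.exists_hidden t <;>
      exact ⟨_, Finset.mem_map_of_mem _ hj⟩

section square

variable (N : HyperNetwork n)

theorem square_output (x : Fin n → Bool) : N.square.output x = N.output x ^ 2 := by
  have h1 : N.square.output x = ∑ h : N.Hidden ⊕ N.Hidden → Bool,
      (∏ t, N.weight t (Sum.elim x fun j => h (Sum.inl j))) *
        ∏ t, N.weight t (Sum.elim x fun j => h (Sum.inr j)) := by
    refine Finset.sum_congr rfl fun h _ => ?_
    refine (Fintype.prod_sum_type _).trans ?_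
    refine congrArg₂ _ (Finset.prod_congr rfl fun t _ => congrArg (N.weight t) ?_)
      (Finset.prod_congr rfl fun t _ => congrArg (N.weight t) ?_) <;>
    · funext v
      rcases v with i | j <;> rfl
  rw [h1, ← (Equiv.sumArrowEquivProdArrow N.Hidden N.Hidden Bool).symm.sum_comp,
    Fintype.sum_prod_type, sq, output, Finset.sum_mul_sum]
  simp [Equiv.sumArrowEquivProdArrow]

theorem square_card_index : Fintype.card N.square.Index = 2 * Fintype.card N.Index :=
  (Fintype.card_sum (α := N.Index) (β := N.Index)).trans (two_mul _).symm

theorem square_card_hidden : Fintype.card N.square.Hidden = 2 * Fintype.card N.Hidden :=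
  (Fintype.card_sum (α := N.Hidden) (β := N.Hidden)).trans (two_mul _).symm

theorem square_card_edge {k : ℕ} (hN : ∀ t, (N.edge t).card ≤ k) (t) :
    (N.square.edge t).card ≤ k := by
  rcases t with t | t <;> exact (Finset.card_map _).le.trans (hN t)

theorem square_degree (hN : ∀ i, N.degree (Sum.inl i) ≤ 1)
    (hN' : ∀ j, N.degree (Sum.inr j) ≤ 2) (v) : N.square.degree v ≤ 2 := by
  have h : N.square.degree v = ∑ t : N.Index ⊕ N.Index,
      if v ∈ N.square.edge t then 1 else 0 := Finset.card_filter _ _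
  rw [h, Fintype.sum_sum_type, ← Finset.card_filter, ← Finset.card_filter]
  have hl' : ∀ v, (Finset.univ.filter fun t => v ∈ N.square.edge (Sum.inl t)) =
    Finset.univ.filter fun t => v ∈
      (N.edge t).map ((Function.Embedding.refl _).sumMap .inl) := fun _ => rfl
  have hr' : ∀ v, (Finset.univ.filter fun t => v ∈ N.square.edge (Sum.inr t)) =
    Finset.univ.filter fun t => v ∈
      (N.edge t).map ((Function.Embedding.refl _).sumMap .inr) := fun _ => rfl
  rw [hl', hr']
  have h0 : ∀ i, (Finset.univ.filter fun t => Sum.inl i ∈ N.edge t).card ≤ 1 := hN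
  have h1 : ∀ i, (Finset.univ.filter fun t => Sum.inr i ∈ N.edge t).card ≤ 2 := hN'
  rcases v with i | j | j
  · simpa using Nat.add_le_add (h0 i) (h0 i)
  · simpa using h1 j
  · simpa using h1 j

end square

/-- The network with the constant `c` added to each weight. -/
def addConst (N : HyperNetwork n) (c : ℝ) (hc : 0 ≤ c) : HyperNetwork n where
  Hidden := N.Hidden
  Index := N.Index
  edge := N.edge
  weight := fun t y => N.weight t y + c
  weight_nonneg := fun t y => add_nonneg (N.weight_nonneg t y) hc
  weight_congr := fun t y z h => by rw [N.weight_congr t y z h]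
  edge_injective := N.edge_injective
  exists_hidden := N.exists_hidden

/-- The Hyper Boltzmann Machine whose Boltzmann weights are the weights of the network, provided
that these are positive. -/
noncomputable def toHBM (N : HyperNetwork n) : HBM n (Fintype.card N.Hidden) where
  edges := Finset.univ.map ⟨fun t => (N.edge t).map
    ((Equiv.refl _).sumCongr (Fintype.equivFin N.Hidden)).toEmbedding,
      (Finset.map_injective _).comp N.edge_injective⟩
  energy := fun e y => Function.extend (fun t => (N.edge t).map
    ((Equiv.refl _).sumCongr (Fintype.equivFin N.Hidden)).toEmbedding)
    (fun t z => -Real.log (N.weight t z)) 0 e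
    (fun v => if h : (Equiv.refl _).sumCongr (Fintype.equivFin N.Hidden) v ∈ e
      then y ⟨_, h⟩ else false)

section toHBM

variable (N : HyperNetwork n)

theorem toHBM_totalEnergy (y) : N.toHBM.totalEnergy y =
    ∑ t, -Real.log (N.weight t (y ∘ (Equiv.refl _).sumCongr (Fintype.equivFin N.Hidden))) := by
  rw [HBM.totalEnergy, toHBM, Finset.sum_map]
  refine Finset.sum_congr rfl fun t _ => ?_
  have hinj : Function.Injective fun t => (N.edge t).map
      ((Equiv.refl _).sumCongr (Fintype.equivFin N.Hidden)).toEmbedding :=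
    (Finset.map_injective _).comp N.edge_injective
  simp only [Function.Embedding.coeFn_mk]
  rw [hinj.extend_apply (fun t z => -Real.log (N.weight t z)) 0 t]
  refine congrArg (fun r => -Real.log r) (N.weight_congr t _ _ fun v hv => ?_)
  exact dif_pos (Finset.mem_map_of_mem _ hv)

theorem toHBM_output (hN : ∀ t y, 0 < N.weight t y) (x : Fin n → Bool) :
    N.toHBM.output x = N.output x := by
  rw [HBM.output, output,
    ← ((Fintype.equivFin N.Hidden).symm.arrowCongr (Equiv.refl Bool)).sum_comp]
  refine Finset.sum_congr rfl fun h _ => ?_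
  rw [toHBM_totalEnergy, ← Finset.sum_neg_distrib, Real.exp_sum]
  refine Finset.prod_congr rfl fun t _ => ?_
  rw [neg_neg, Real.exp_log (hN _ _)]
  congr 1
  funext v
  rcases v with i | j <;> simp [Equiv.arrowCongr]

theorem toHBM_card_edges : N.toHBM.edges.card = Fintype.card N.Index :=
  Finset.card_map _

theorem toHBM_isLocal {k : ℕ} (hN : ∀ t, (N.edge t).card ≤ k) : N.toHBM.IsLocal k := by
  intro e he
  obtain ⟨t, -, rfl⟩ := Finset.mem_map.1 he
  exact (Finset.card_map _).le.trans (hN t)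

theorem toHBM_degree {d : ℕ} (hN : ∀ v, N.degree v ≤ d) (v) : N.toHBM.degree v ≤ d := by
  refine le_trans (le_of_eq ?_)
    (hN (((Equiv.refl _).sumCongr (Fintype.equivFin N.Hidden)).symm v))
  rw [HBM.degree, toHBM, Finset.filter_map, Finset.card_map, degree]
  refine congrArg Finset.card (Finset.filter_congr fun t _ => ?_)
  simp only [Function.comp, Function.Embedding.coeFn_mk, Finset.mem_map_equiv]

/-- The output distribution of a network with non-negative weights is a limit of output
distributions of Hyper Boltzmann Machines on the same hypergraph. -/
theorem exists_hbm (ψ : QubitSpace n) {ε : ℝ} {k d : ℕ} (hpos : 0 < ∑ x, N.output x)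
    (hN : (1 / 2 : ℝ) * ∑ x, |N.output x / (∑ y, N.output y) - ‖ψ x‖ ^ 2| < ε)
    (hk : ∀ t, (N.edge t).card ≤ k) (hd : ∀ v, N.degree v ≤ d) :
    ∃ B : HBM n (Fintype.card N.Hidden), B.IsLocal k ∧ B.edges.card = Fintype.card N.Index ∧
      (∀ v, B.degree v ≤ d) ∧ B.RepresentsInDistribution ψ ε := by
  let F : ℝ → (Fin n → Bool) → ℝ := fun c x =>
    ∑ h : N.Hidden → Bool, ∏ t, (N.weight t (Sum.elim x h) + c)
  have hF : ∀ x, Continuous fun c => F c x := fun x => by fun_prop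
  have hF0 : ∀ x, F 0 x = N.output x := fun x => by simp [F, output]
  have hcont : ContinuousAt (fun c => (1 / 2 : ℝ) *
      ∑ x, |F c x / (∑ y, F c y) - ‖ψ x‖ ^ 2|) 0 := by
    refine continuousAt_const.mul (tendsto_finsetSum _ fun x _ => ?_)
    refine ContinuousAt.abs (ContinuousAt.sub (ContinuousAt.div (hF x).continuousAt
      (continuous_finsetSum _ fun y _ => hF y).continuousAt ?_) continuousAt_const)
    simpa only [hF0] using hpos.ne'
  -- The error depends continuously on the added constant `c` and is below `ε` at `c = 0`, so it
  -- stays below for some `c > 0`, where all weights are positive.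
  have hev := hcont.eventually_lt_const (by simpa only [hF0] using hN)
  obtain ⟨c, hc, hc0⟩ := ((hev.filter_mono nhdsWithin_le_nhds).and
    (self_mem_nhdsWithin : Set.Ioi (0 : ℝ) ∈ nhdsWithin 0 (Set.Ioi 0))).exists
  have hc0' : (0 : ℝ) < c := hc0
  refine ⟨(N.addConst c hc0'.le).toHBM, toHBM_isLocal _ hk, toHBM_card_edges _,
    toHBM_degree _ hd, ?_⟩
  have hout : (N.addConst c hc0'.le).toHBM.output = F c := funext <|
    toHBM_output _ fun t y => add_pos_of_nonneg_of_pos (N.weight_nonneg t y) hc0'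
  exact (congrArg (fun f : (Fin n → Bool) → ℝ =>
    (1 / 2 : ℝ) * ∑ x, |f x / (∑ y, f y) - ‖ψ x‖ ^ 2|) hout).le.trans hc.le

end toHBM

end HyperNetwork

/-! ### Products of damping operators and their contraction rate -/

section damping

variable {E : Type*} [NormedAddCommGroup E] [InnerProductSpace ℂ E]

/-- Apply `1 - A 0`, `1 - A 1`, … one after the other to `φ`. -/
def dampSeq (A : ℕ → E →ₗ[ℂ] E) (φ : E) : ℕ → E
  | 0 => φ
  | j + 1 => dampSeq A φ j - A j (dampSeq A φ j)

theorem dampSeq_add_index (A : ℕ → E →ₗ[ℂ] E) (φ : E) (s j : ℕ) :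
    dampSeq A φ (s + j) = dampSeq (fun i => A (s + i)) (dampSeq A φ s) j := by
  induction j with
  | zero => rfl
  | succ j ih => rw [← add_assoc, dampSeq, dampSeq, ih]

theorem dampSeq_add (A : ℕ → E →ₗ[ℂ] E) (φ ψ : E) (j : ℕ) :
    dampSeq A (φ + ψ) j = dampSeq A φ j + dampSeq A ψ j := by
  induction j with
  | zero => rfl
  | succ j ih => simp only [dampSeq, ih, map_add]; abel

theorem dampSeq_eq_self {A : ℕ → E →ₗ[ℂ] E} {φ : E} (h : ∀ j, A j φ = 0) (j : ℕ) :
    dampSeq A φ j = φ := by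
  induction j with
  | zero => rfl
  | succ j ih => rw [dampSeq, ih, h, sub_zero]

theorem dampSeq_mem {A : ℕ → E →ₗ[ℂ] E} {K : Submodule ℂ E} (hK : ∀ j, ∀ v ∈ K, A j v ∈ K)
    {φ : E} (hφ : φ ∈ K) (j : ℕ) : dampSeq A φ j ∈ K := by
  induction j with
  | zero => exact hφ
  | succ j ih => exact K.sub_mem ih (hK _ _ ih)

/-- `0 ≤ A ≤ 1` for symmetric `A`, expressed by `A² ≤ A`. -/
def IsDamping (A : E →ₗ[ℂ] E) : Prop := ∀ v, ‖A v‖ ^ 2 ≤ (inner ℂ v (A v)).re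

namespace IsDamping

variable {A : E →ₗ[ℂ] E}

theorem nonneg (hA : IsDamping A) (v : E) : 0 ≤ (inner ℂ v (A v)).re :=
  (sq_nonneg _).trans (hA v)

theorem re_inner_le (hA : IsDamping A) (v : E) : (inner ℂ v (A v)).re ≤ ‖v‖ ^ 2 := by
  have h1 : (inner ℂ v (A v)).re ≤ ‖v‖ * ‖A v‖ := re_inner_le_norm (𝕜 := ℂ) v (A v)
  nlinarith [hA v, sq_nonneg (‖v‖ - ‖A v‖), sq_nonneg ‖v‖]

/-- Parallelogram law for the form of `A`, dropping the non-negative term at `u - v`. -/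
theorem re_inner_add_le (hA : IsDamping A) (u v : E) :
    (inner ℂ (u + v) (A (u + v))).re ≤
      2 * (inner ℂ u (A u)).re + 2 * (inner ℂ v (A v)).re := by
  have h := hA.nonneg (u - v)
  simp only [map_sub, map_add, inner_sub_left, inner_sub_right, inner_add_left, inner_add_right,
    Complex.sub_re, Complex.add_re] at h ⊢
  linarith

theorem norm_sub_sq_le (hA : IsDamping A) (v : E) :
    ‖v - A v‖ ^ 2 + (inner ℂ v (A v)).re ≤ ‖v‖ ^ 2 := by
  have h := norm_sub_sq (𝕜 := ℂ) v (A v)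
  have h' := hA v
  simp only [RCLike.re_to_complex] at h
  linarith

end IsDamping

theorem norm_dampSeq_sq_add_sum_le {A : ℕ → E →ₗ[ℂ] E} (hA : ∀ j, IsDamping (A j)) (φ : E)
    (j : ℕ) : ‖dampSeq A φ j‖ ^ 2 +
      ∑ i ∈ Finset.range j, (inner ℂ (dampSeq A φ i) (A i (dampSeq A φ i))).re ≤ ‖φ‖ ^ 2 := by
  induction j with
  | zero => simp [dampSeq]
  | succ j ih =>
    have := (hA j).norm_sub_sq_le (dampSeq A φ j)
    rw [Finset.sum_range_succ, dampSeq]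
    linarith

/-- The displacement is the sum of the individual steps; Cauchy–Schwarz and `‖A v‖² ≤ ⟨v, A v⟩`
bound it by the quantity that also bounds the norm loss. -/
theorem norm_sub_dampSeq_sq_le {A : ℕ → E →ₗ[ℂ] E} (hA : ∀ j, IsDamping (A j)) (φ : E)
    (j : ℕ) : ‖φ - dampSeq A φ j‖ ^ 2 ≤
      j * ∑ i ∈ Finset.range j, (inner ℂ (dampSeq A φ i) (A i (dampSeq A φ i))).re := by
  have h1 : φ - dampSeq A φ j = ∑ i ∈ Finset.range j, A i (dampSeq A φ i) := by
    induction j with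
    | zero => simp [dampSeq]
    | succ j ih => rw [Finset.sum_range_succ, ← ih, dampSeq]; abel
  calc ‖φ - dampSeq A φ j‖ ^ 2 ≤ (∑ i ∈ Finset.range j, ‖A i (dampSeq A φ i)‖) ^ 2 := by
        rw [h1]
        exact pow_le_pow_left₀ (norm_nonneg _) (norm_sum_le _ _) 2
    _ ≤ j * ∑ i ∈ Finset.range j, ‖A i (dampSeq A φ i)‖ ^ 2 := by
        simpa using sq_sum_le_card_mul_sum_sq (s := Finset.range j)
          (f := fun i => ‖A i (dampSeq A φ i)‖)
    _ ≤ _ := by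
        gcongr with i
        exact hA i _

/-- One round of `L` damping steps contracts a vector on which the sum of the damping operators
is bounded below. -/
theorem norm_dampSeq_sq_le {A : ℕ → E →ₗ[ℂ] E} (hA : ∀ j, IsDamping (A j)) {φ : E} {γ : ℝ}
    {L : ℕ} (hL : 1 ≤ L)
    (hγ : γ * ‖φ‖ ^ 2 ≤ ∑ j ∈ Finset.range L, (inner ℂ φ (A j φ)).re) :
    ‖dampSeq A φ L‖ ^ 2 ≤ Real.exp (-(γ / (4 * L ^ 2))) * ‖φ‖ ^ 2 := by
  set d : ℕ → ℝ := fun i => (inner ℂ (dampSeq A φ i) (A i (dampSeq A φ i))).re with hd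
  have hd0 : ∀ i, 0 ≤ d i := fun i => (hA i).nonneg _
  set D := ∑ i ∈ Finset.range L, d i with hD
  have hD0 : 0 ≤ D := Finset.sum_nonneg fun i _ => hd0 i
  have hL' : (1 : ℝ) ≤ L := by exact_mod_cast hL
  have h1 : ‖dampSeq A φ L‖ ^ 2 + D ≤ ‖φ‖ ^ 2 := norm_dampSeq_sq_add_sum_le hA φ L
  -- Split `φ` into the current vector, whose form value is `d j`, and the displacement so far,
  -- whose squared norm is at most `L * D`.
  have h2 : ∀ j ∈ Finset.range L, (inner ℂ φ (A j φ)).re ≤ 2 * d j + 2 * (L * D) := by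
    intro j hj
    have hj' : j ≤ L := (Finset.mem_range.1 hj).le
    have h3 := (hA j).re_inner_add_le (dampSeq A φ j) (φ - dampSeq A φ j)
    have h4 := (hA j).re_inner_le (φ - dampSeq A φ j)
    have h5 : ‖φ - dampSeq A φ j‖ ^ 2 ≤ L * D := by
      refine (norm_sub_dampSeq_sq_le hA φ j).trans (mul_le_mul (by exact_mod_cast hj') ?_
        (Finset.sum_nonneg fun i _ => hd0 i) (by positivity))
      exact Finset.sum_le_sum_of_subset_of_nonneg (Finset.range_mono hj') fun i _ _ => hd0 i
    rw [add_sub_cancel] at h3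
    linarith
  have h3 : γ * ‖φ‖ ^ 2 ≤ 2 * D + L * (2 * (L * D)) := by
    refine hγ.trans ((Finset.sum_le_sum h2).trans (le_of_eq ?_))
    rw [Finset.sum_add_distrib, ← Finset.mul_sum]
    simp [hD]
  -- Here `2 + 2 L² ≤ 4 L²` since `L ≥ 1`.
  have h4 : γ * ‖φ‖ ^ 2 ≤ 4 * (L : ℝ) ^ 2 * D := by
    nlinarith [mul_le_mul_of_nonneg_right (one_le_pow₀ hL' (n := 2)) hD0]
  have h5 : γ / (4 * L ^ 2) * ‖φ‖ ^ 2 ≤ D := by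
    rw [div_mul_eq_mul_div, div_le_iff₀ (by positivity)]
    linarith
  have h6 := Real.add_one_le_exp (-(γ / (4 * (L : ℝ) ^ 2)))
  nlinarith [sq_nonneg ‖φ‖]

theorem norm_dampSeq_sq_le_exp {A : ℕ → E →ₗ[ℂ] E} (hA : ∀ j, IsDamping (A j))
    {K : Submodule ℂ E} (hK : ∀ j, ∀ v ∈ K, A j v ∈ K) {γ : ℝ} {L : ℕ} (hL : 1 ≤ L)
    (hγ : ∀ s, ∀ φ ∈ K,
      γ * ‖φ‖ ^ 2 ≤ ∑ j ∈ Finset.range L, (inner ℂ φ (A (s * L + j) φ)).re)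
    {φ : E} (hφ : φ ∈ K) (N : ℕ) :
    ‖dampSeq A φ (N * L)‖ ^ 2 ≤ Real.exp (-(N * (γ / (4 * L ^ 2)))) * ‖φ‖ ^ 2 := by
  induction N with
  | zero => simp [dampSeq]
  | succ N ih =>
    rw [Nat.succ_mul, dampSeq_add_index]
    refine (norm_dampSeq_sq_le (fun j => hA _) hL (hγ N _ (dampSeq_mem hK hφ _))).trans ?_
    refine (mul_le_mul_of_nonneg_left ih (Real.exp_pos _).le).trans (le_of_eq ?_)
    rw [← mul_assoc, ← Real.exp_add]
    push_cast
    ring_nf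

end damping

/-! ### Total variation distance from Hilbert space distance -/

section distributions

variable {ι : Type*} [Fintype ι]

/-- Factor each difference of squares and apply Cauchy–Schwarz; the squares of `‖a x‖ + ‖b x‖` sum
to at most 4, which cancels the factor 1/4. -/
theorem total_variation_le (a b : EuclideanSpace ℂ ι) (ha : ‖a‖ = 1) (hb : ‖b‖ = 1) :
    ((1 / 2 : ℝ) * ∑ x, |‖a x‖ ^ 2 - ‖b x‖ ^ 2|) ^ 2 ≤ ‖a - b‖ ^ 2 := by
  have h1 : ∑ x, |‖a x‖ ^ 2 - ‖b x‖ ^ 2| ≤ ∑ x, ‖(a - b) x‖ * (‖a x‖ + ‖b x‖) := by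
    refine Finset.sum_le_sum fun x _ => ?_
    rw [sq_sub_sq, abs_mul, mul_comm, abs_of_nonneg (by positivity : 0 ≤ ‖a x‖ + ‖b x‖)]
    exact mul_le_mul_of_nonneg_right (abs_norm_sub_norm_le _ _) (by positivity)
  have h2 := Finset.sum_mul_sq_le_sq_mul_sq Finset.univ (fun x => ‖(a - b) x‖)
    (fun x => ‖a x‖ + ‖b x‖)
  have h3 : ∑ x, (‖a x‖ + ‖b x‖) ^ 2 ≤ 4 := by
    have h4 : ∑ x, (‖a x‖ + ‖b x‖) ^ 2 ≤ ∑ x, (2 * ‖a x‖ ^ 2 + 2 * ‖b x‖ ^ 2) :=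
      Finset.sum_le_sum fun x _ => by nlinarith [sq_nonneg (‖a x‖ - ‖b x‖)]
    rw [Finset.sum_add_distrib, ← Finset.mul_sum, ← Finset.mul_sum, ← EuclideanSpace.norm_sq_eq,
      ← EuclideanSpace.norm_sq_eq, ha, hb] at h4
    linarith
  rw [← EuclideanSpace.norm_sq_eq] at h2
  have h0 : 0 ≤ ∑ x, |‖a x‖ ^ 2 - ‖b x‖ ^ 2| := Finset.sum_nonneg fun _ _ => abs_nonneg _
  have h5 := pow_le_pow_left₀ h0 h1 2
  nlinarith [mul_le_mul_of_nonneg_left h3 (sq_nonneg ‖a - b‖)]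

/-- Total variation distance between the distributions of a state and of its projection. -/
theorem total_variation_normalize_le {u v : EuclideanSpace ℂ ι} (hu : u ≠ 0) (hv : v ≠ 0)
    (huv : (inner ℂ u v).re = ‖v‖ ^ 2) :
    ((1 / 2 : ℝ) * ∑ x, |‖u x‖ ^ 2 / ‖u‖ ^ 2 - ‖(((‖v‖⁻¹ : ℝ) : ℂ) • v) x‖ ^ 2|) ^ 2 ≤
      2 - 2 * (‖v‖ / ‖u‖) := by
  have hu' := norm_pos_iff.2 hu
  have hv' := norm_pos_iff.2 hv
  have hn : ∀ w : EuclideanSpace ℂ ι, w ≠ 0 → ‖((‖w‖⁻¹ : ℝ) : ℂ) • w‖ = 1 := by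
    intro w hw
    rw [norm_smul, Complex.norm_real, norm_inv, norm_norm, inv_mul_cancel₀ (norm_ne_zero_iff.2 hw)]
  have h := total_variation_le (((‖u‖⁻¹ : ℝ) : ℂ) • u) (((‖v‖⁻¹ : ℝ) : ℂ) • v) (hn u hu) (hn v hv)
  rw [norm_sub_sq (𝕜 := ℂ), hn u hu, hn v hv, inner_smul_left, inner_smul_right,
    Complex.conj_ofReal] at h
  have h1 : ∀ x, ‖(((‖u‖⁻¹ : ℝ) : ℂ) • u) x‖ ^ 2 = ‖u x‖ ^ 2 / ‖u‖ ^ 2 := by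
    intro x
    rw [PiLp.smul_apply, norm_smul, Complex.norm_real, norm_inv, norm_norm]
    field_simp
  simp only [h1, RCLike.re_to_complex, Complex.re_ofReal_mul, huv] at h
  refine h.trans (le_of_eq ?_)
  field_simp
  ring

end distributions

/-! ### Ground energy, spectral gap, and the operators τ(A - E) -/

section spectral

variable {n : ℕ} {A : QubitMatrix n}

theorem toEuclideanLin_eigenvectorBasis (hA : A.IsHermitian) (i) :
    Matrix.toEuclideanLin A (hA.eigenvectorBasis i) =
      (hA.eigenvalues i : ℂ) • hA.eigenvectorBasis i := by
  ext x
  have := congrFun (hA.mulVec_eigenvectorBasis i) x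
  simpa using this

theorem inner_eigenvectorBasis_toEuclideanLin (hA : A.IsHermitian) (i) (v : QubitSpace n) :
    inner ℂ (hA.eigenvectorBasis i) (Matrix.toEuclideanLin A v) =
      hA.eigenvalues i * inner ℂ (hA.eigenvectorBasis i) v := by
  rw [← (Matrix.isSymmetric_toEuclideanLin_iff.2 hA) _ v, toEuclideanLin_eigenvectorBasis,
    inner_smul_left, Complex.conj_ofReal]

theorem re_inner_toEuclideanLin (hA : A.IsHermitian) (v : QubitSpace n) :
    (inner ℂ v (Matrix.toEuclideanLin A v)).re =
      ∑ i, hA.eigenvalues i * ‖inner ℂ (hA.eigenvectorBasis i) v‖ ^ 2 := by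
  rw [← hA.eigenvectorBasis.sum_inner_mul_inner v, Complex.re_sum]
  refine Finset.sum_congr rfl fun i _ => ?_
  rw [inner_eigenvectorBasis_toEuclideanLin, mul_left_comm, Complex.re_ofReal_mul,
    ← inner_conj_symm v, ← Complex.normSq_eq_conj_mul_self, Complex.ofReal_re,
    Complex.normSq_eq_norm_sq]

theorem norm_sq_eq_sum_eigenvectorBasis (hA : A.IsHermitian) (v : QubitSpace n) :
    ‖v‖ ^ 2 = ∑ i, ‖inner ℂ (hA.eigenvectorBasis i) v‖ ^ 2 :=
  (hA.eigenvectorBasis.sum_sq_norm_inner_right v).symm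

theorem groundEnergy_le_eigenvalues (hA : A.IsHermitian) (i) :
    groundEnergy A ≤ hA.eigenvalues i :=
  csInf_le A.finite_real_spectrum.bddBelow (hA.eigenvalues_mem_spectrum_real i)

theorem exists_eigenvalues_eq_groundEnergy (hA : A.IsHermitian) :
    ∃ i, hA.eigenvalues i = groundEnergy A := by
  have h : groundEnergy A ∈ spectrum ℝ A := by
    refine Set.Nonempty.csInf_mem ?_ A.finite_real_spectrum
    exact ⟨_, hA.eigenvalues_mem_spectrum_real fun _ => false⟩
  rwa [hA.spectrum_real_eq_range_eigenvalues] at h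

theorem mem_groundSpace {v : QubitSpace n} :
    v ∈ groundSpace A ↔ Matrix.toEuclideanLin A v = (groundEnergy A : ℂ) • v :=
  Module.End.mem_eigenspace_iff

theorem groundEnergy_mul_le (hA : A.IsHermitian) (v : QubitSpace n) :
    groundEnergy A * ‖v‖ ^ 2 ≤ (inner ℂ v (Matrix.toEuclideanLin A v)).re := by
  rw [re_inner_toEuclideanLin hA, norm_sq_eq_sum_eigenvectorBasis hA, Finset.mul_sum]
  exact Finset.sum_le_sum fun i _ =>
    mul_le_mul_of_nonneg_right (groundEnergy_le_eigenvalues hA i) (sq_nonneg _)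

theorem gap_mul_le (hA : A.IsHermitian) {Δ : ℝ} (hΔ : HasEnergyGap A Δ) {v : QubitSpace n}
    (hv : v ∈ (groundSpace A)ᗮ) :
    (groundEnergy A + Δ) * ‖v‖ ^ 2 ≤ (inner ℂ v (Matrix.toEuclideanLin A v)).re := by
  rw [re_inner_toEuclideanLin hA, norm_sq_eq_sum_eigenvectorBasis hA, Finset.mul_sum]
  refine Finset.sum_le_sum fun i _ => ?_
  by_cases hi : hA.eigenvalues i = groundEnergy A
  · have : inner ℂ (hA.eigenvectorBasis i) v = 0 :=
      hv _ (mem_groundSpace.2 (by rw [toEuclideanLin_eigenvectorBasis, hi]))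
    simp [this]
  · exact mul_le_mul_of_nonneg_right (hΔ.2 _ (hA.eigenvalues_mem_spectrum_real i) hi)
      (sq_nonneg _)

/-- Equality case of the variational principle: termwise equality in the eigenbasis kills every
coefficient whose eigenvalue is not the ground energy. -/
theorem mem_groundSpace_of_re_inner_le (hA : A.IsHermitian) {v : QubitSpace n}
    (hv : (inner ℂ v (Matrix.toEuclideanLin A v)).re ≤ groundEnergy A * ‖v‖ ^ 2) :
    v ∈ groundSpace A := by
  rw [re_inner_toEuclideanLin hA, norm_sq_eq_sum_eigenvectorBasis hA, Finset.mul_sum] at hv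
  have h1 : ∀ i ∈ Finset.univ, groundEnergy A * ‖inner ℂ (hA.eigenvectorBasis i) v‖ ^ 2 ≤
      hA.eigenvalues i * ‖inner ℂ (hA.eigenvectorBasis i) v‖ ^ 2 := fun i _ =>
    mul_le_mul_of_nonneg_right (groundEnergy_le_eigenvalues hA i) (sq_nonneg _)
  have h2 := (Finset.sum_eq_sum_iff_of_le h1).1 (le_antisymm (Finset.sum_le_sum h1) hv)
  rw [mem_groundSpace]
  refine hA.eigenvectorBasis.repr.injective (PiLp.ext fun i => ?_)
  rw [OrthonormalBasis.repr_apply_apply, OrthonormalBasis.repr_apply_apply, inner_eigenvectorBasis_toEuclideanLin, inner_smul_right]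
  rcases mul_eq_mul_right_iff.1 (h2 i (Finset.mem_univ i)) with h | h
  · rw [h]
  · rw [norm_eq_zero.1 (pow_eq_zero_iff (two_ne_zero)|>.1 h), mul_zero, mul_zero]

theorem norm_toEuclideanLin_le (A : QubitMatrix n) (v : QubitSpace n) :
    ‖Matrix.toEuclideanLin A v‖ ≤ opNorm A * ‖v‖ :=
  (Matrix.toEuclideanCLM (n := Fin n → Bool) (𝕜 := ℂ) A).le_opNorm v

theorem abs_groundEnergy_le (hA : A.IsHermitian) : |groundEnergy A| ≤ opNorm A := by
  obtain ⟨i, hi⟩ := exists_eigenvalues_eq_groundEnergy hA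
  have h := norm_toEuclideanLin_le A (hA.eigenvectorBasis i)
  rw [toEuclideanLin_eigenvectorBasis, norm_smul, hi, hA.eigenvectorBasis.norm_eq_one,
    Complex.norm_real, Real.norm_eq_abs] at h
  simpa using h

/-- The operator `τ (A - E)`, where `E` is the ground energy of `A`. -/
noncomputable def excitation (A : QubitMatrix n) (τ : ℝ) : QubitSpace n →ₗ[ℂ] QubitSpace n :=
  (τ : ℂ) • (Matrix.toEuclideanLin A - (groundEnergy A : ℂ) • LinearMap.id)

theorem excitation_apply (A : QubitMatrix n) (τ : ℝ) (v : QubitSpace n) :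
    excitation A τ v = (τ : ℂ) • (Matrix.toEuclideanLin A v - (groundEnergy A : ℂ) • v) := rfl

theorem re_inner_excitation (A : QubitMatrix n) (τ : ℝ) (v : QubitSpace n) :
    (inner ℂ v (excitation A τ v)).re =
      τ * ((inner ℂ v (Matrix.toEuclideanLin A v)).re - groundEnergy A * ‖v‖ ^ 2) := by
  rw [excitation_apply, inner_smul_right, inner_sub_right, inner_smul_right,
    inner_self_eq_norm_sq_to_K, Complex.re_ofReal_mul, Complex.sub_re, Complex.re_ofReal_mul]
  congr 3
  norm_cast

theorem excitation_eq_zero {v : QubitSpace n} (hv : v ∈ groundSpace A) (τ : ℝ) :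
    excitation A τ v = 0 := by
  rw [excitation_apply, mem_groundSpace.1 hv, sub_self, smul_zero]

theorem excitation_isSymmetric (hA : A.IsHermitian) (τ : ℝ) : (excitation A τ).IsSymmetric := by
  intro u v
  simp only [excitation_apply, inner_smul_left, inner_smul_right, inner_sub_left, inner_sub_right,
    Complex.conj_ofReal, (Matrix.isSymmetric_toEuclideanLin_iff.2 hA) u v]

theorem excitation_mem_orthogonal (hA : A.IsHermitian) (τ : ℝ) {K : Submodule ℂ (QubitSpace n)}
    (hK : K ≤ groundSpace A) (v : QubitSpace n) :
    excitation A τ v ∈ Kᗮ := by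
  intro g hg
  rw [← excitation_isSymmetric hA τ g v, excitation_eq_zero (hK hg), inner_zero_left]

theorem norm_excitation_le (hA : A.IsHermitian) {J τ : ℝ} (hτ : 0 ≤ τ) (hJ : opNorm A ≤ J)
    (v : QubitSpace n) : ‖excitation A τ v‖ ≤ 2 * J * τ * ‖v‖ := by
  rw [excitation_apply, norm_smul, Complex.norm_real, Real.norm_of_nonneg hτ]
  have h1 : ‖Matrix.toEuclideanLin A v - (groundEnergy A : ℂ) • v‖ ≤ J * ‖v‖ + J * ‖v‖ := by
    refine (norm_sub_le _ _).trans (add_le_add ?_ ?_)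
    · exact (norm_toEuclideanLin_le A v).trans (by gcongr)
    · rw [norm_smul, Complex.norm_real, Real.norm_eq_abs]
      gcongr
      exact (abs_groundEnergy_le hA).trans hJ
  nlinarith

/-- With `B` the operator, expand `⟨v - Bv, B(v - Bv)⟩ ≥ 0`; since `‖B‖ ≤ 1`, the cubic term is at
most `‖Bv‖²`, leaving `‖Bv‖² ≤ ⟨v, Bv⟩`. -/
theorem excitation_isDamping (hA : A.IsHermitian) {J τ : ℝ} (hτ : 0 ≤ τ) (hJ : opNorm A ≤ J)
    (hJτ : 2 * J * τ ≤ 1) : IsDamping (excitation A τ) := by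
  intro v
  set B := excitation A τ
  have hle : ∀ v, ‖B v‖ ≤ ‖v‖ := fun v =>
    (norm_excitation_le hA hτ hJ v).trans (mul_le_of_le_one_left (norm_nonneg _) hJτ)
  have h0 : 0 ≤ (inner ℂ (v - B v) (B (v - B v))).re := by
    rw [re_inner_excitation]
    exact mul_nonneg hτ (sub_nonneg.2 (groundEnergy_mul_le hA _))
  have h1 : (inner ℂ v (B (B v))).re = ‖B v‖ ^ 2 := by
    rw [← excitation_isSymmetric hA τ v (B v)]
    exact inner_self_eq_norm_sq (𝕜 := ℂ) (B v)
  have h2 : (inner ℂ (B v) (B v)).re = ‖B v‖ ^ 2 := inner_self_eq_norm_sq (𝕜 := ℂ) (B v)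
  have h3 : (inner ℂ (B v) (B (B v))).re ≤ ‖B v‖ ^ 2 :=
    (re_inner_le_norm (𝕜 := ℂ) _ _).trans (by nlinarith [hle (B v), norm_nonneg (B v)])
  simp only [map_sub, inner_sub_left, inner_sub_right, Complex.sub_re, h1, h2] at h0
  linarith

end spectral

/-! ### Local operators as gates with non-negative weights -/

section gates

variable {n : ℕ} {A : QubitMatrix n} {S : Finset (Fin n)}

theorem ActsOn.mono {S' : Finset (Fin n)} (hA : ActsOn A S) (hS : S ⊆ S') : ActsOn A S' := by
  obtain ⟨h, hh⟩ := hA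
  refine ⟨fun u z => if ∀ i : S', (i : Fin n) ∉ S → u i = z i then
    h (fun i => u ⟨i, hS i.2⟩) (fun i => z ⟨i, hS i.2⟩) else 0, fun x y => ?_⟩
  rw [hh, ← ite_and]
  refine if_congr ⟨fun H => ⟨fun i hi => H i fun hi' => hi (hS hi'), fun i hi => H i hi⟩,
    fun H i hi => ?_⟩ rfl rfl
  by_cases hi' : i ∈ S'
  · exact H.2 ⟨i, hi'⟩ hi
  · exact H.1 i hi'

theorem ActsOn.sum {ι : Type*} {s : Finset ι} {B : ι → QubitMatrix n}
    (hB : ∀ a, ActsOn (B a) S) : ActsOn (∑ a ∈ s, B a) S := by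
  choose h hh using hB
  refine ⟨∑ a ∈ s, h a, fun x y => ?_⟩
  rw [Matrix.sum_apply, Matrix.sum_apply]
  simp only [hh]
  split_ifs <;> simp

open HyperNetwork in
theorem overwrite_restrict (x : Fin n → Bool) : overwrite x (fun i : S => x i) = x := by
  funext i
  simp [overwrite]

open HyperNetwork in
theorem overwrite_apply_coe (x : Fin n → Bool) (z : S → Bool) (i : S) :
    overwrite x z i = z i := by
  simp [overwrite]

open HyperNetwork in
theorem overwrite_injective (x : Fin n → Bool) :
    Function.Injective (overwrite x : (S → Bool) → Fin n → Bool) := by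
  intro z z' h
  funext i
  rw [← overwrite_apply_coe x z, h, overwrite_apply_coe]

open HyperNetwork in
theorem apply_overwrite {h : Matrix (S → Bool) (S → Bool) ℂ}
    (hh : ∀ x y : Fin n → Bool,
      A x y = if (∀ i, i ∉ S → x i = y i) then h (fun i => x i) (fun i => y i) else 0)
    (x : Fin n → Bool) (z : S → Bool) : A x (overwrite x z) = h (fun i => x i) z := by
  rw [hh, if_pos (fun i hi => by simp [overwrite, hi])]
  simp only [overwrite_apply_coe]

open HyperNetwork in
theorem mulVec_eq_sum_overwrite {h : Matrix (S → Bool) (S → Bool) ℂ}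
    (hh : ∀ x y : Fin n → Bool,
      A x y = if (∀ i, i ∉ S → x i = y i) then h (fun i => x i) (fun i => y i) else 0)
    (v : QubitSpace n) (x : Fin n → Bool) : Matrix.toEuclideanLin A v x =
      ∑ z : S → Bool, h (fun i => x i) z * v (overwrite x z) := by
  have h1 : Matrix.toEuclideanLin A v x = ∑ y, A x y * v y := rfl
  rw [h1]
  refine (Finset.sum_of_injOn (overwrite x) (overwrite_injective x).injOn
    (fun _ _ => Finset.mem_coe.2 (Finset.mem_univ _)) (fun y _ hy => ?_) fun z _ => ?_).symm
  · rw [hh, if_neg, zero_mul]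
    intro H
    refine hy ⟨fun i => y i, by simp, ?_⟩
    funext i
    by_cases hi : i ∈ S
    · simp [overwrite, hi]
    · simp [overwrite, hi, H i hi]
  · rw [apply_overwrite hh]

/-- Real entries, non-positive off the diagonal. -/
def IsStoquasticMatrix (A : QubitMatrix n) : Prop :=
  ∀ x y, (A x y).im = 0 ∧ (x ≠ y → (A x y).re ≤ 0)

theorem Matrix.IsHermitian.isStoquasticMatrix (hA : A.IsHermitian)
    (h : ∀ x y, x ≠ y → (A x y).im = 0 ∧ (A x y).re ≤ 0) : IsStoquasticMatrix A := by
  intro x y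
  by_cases hxy : x = y
  · subst hxy
    exact ⟨Complex.conj_eq_iff_im.1 (hA.apply x x), fun h => absurd rfl h⟩
  · exact ⟨(h x y hxy).1, fun _ => (h x y hxy).2⟩

open HyperNetwork in
/-- For small `τ`, the operator `1 - τ (A - E)` is a gate with non-negative weights. -/
theorem exists_gate_weight (hst : IsStoquasticMatrix A) (hS : ActsOn A S)
    {τ : ℝ} (hτ : 0 ≤ τ) (hd : IsDamping (excitation A τ)) :
    ∃ w : (S → Bool) → (S → Bool) → ℝ, (∀ u z, 0 ≤ w u z) ∧
      ∀ (v : QubitSpace n) (f : (Fin n → Bool) → ℝ), (∀ x, v x = (f x : ℂ)) →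
        ∀ x, (v - excitation A τ v) x =
          ((∑ z, w (fun i => x i) z * f (overwrite x z) : ℝ) : ℂ) := by
  obtain ⟨h, hh⟩ := hS
  refine ⟨fun u z => (if u = z then 1 + τ * groundEnergy A else 0) - τ * (h u z).re, ?_, ?_⟩
  · intro u z
    set x : Fin n → Bool := overwrite (fun _ => false) u with hx
    have hxu : (fun i : S => x i) = u := funext fun i => overwrite_apply_coe _ _ i
    have h1 : A x (overwrite x z) = h u z := by rw [apply_overwrite hh, hxu]
    by_cases huz : u = z
    · subst huz
      have h2 : overwrite x u = x := by
        conv_lhs => rw [← hxu]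
        exact overwrite_restrict x
      rw [h2] at h1
      -- Testing the damping bound on a basis state gives `τ (A x x - E) ≤ 1`, which is
      -- non-negativity of the diagonal weight.
      have h3 := hd.re_inner_le (EuclideanSpace.single x 1)
      rw [EuclideanSpace.inner_single_left, excitation_apply, PiLp.smul_apply, PiLp.sub_apply,
        PiLp.smul_apply] at h3
      have h4 : Matrix.toEuclideanLin A (EuclideanSpace.single x 1) x = A x x := by
        simp [Matrix.toLpLin_apply]
      rw [h4, h1] at h3
      simp at h3
      simp only [if_true]
      linarith
    · have h2 : x ≠ overwrite x z := by
        intro H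
        apply huz
        rw [← hxu]
        funext i
        conv_lhs => rw [H]
        exact overwrite_apply_coe _ _ _
      have h3 := (hst x _).2 h2
      rw [h1] at h3
      simp only [if_neg huz]
      nlinarith
  · intro v f hv x
    rw [PiLp.sub_apply, excitation_apply, PiLp.smul_apply, PiLp.sub_apply, PiLp.smul_apply,
      mulVec_eq_sum_overwrite hh]
    have h1 : ∀ z, h (fun i => x i) z = ((h (fun i => x i) z).re : ℂ) := by
      intro z
      have h2 := (hst x (overwrite x z)).1
      rw [apply_overwrite hh] at h2
      exact Complex.ext (by simp) (by simpa using h2)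
    simp only [sub_mul, Finset.sum_sub_distrib, ite_mul, zero_mul, Finset.sum_ite_eq,
      Finset.mem_univ, if_true, overwrite_restrict]
    have h3 : ∑ z : S → Bool, h (fun i => x i) z * v (overwrite x z) =
        ((∑ z : S → Bool, (h (fun i => x i) z).re * f (overwrite x z) : ℝ) : ℂ) := by
      push_cast
      exact Finset.sum_congr rfl fun z _ => by rw [← h1, hv]
    rw [h3, hv]
    simp only [mul_assoc, ← Finset.mul_sum]
    push_cast
    simp only [smul_eq_mul]
    ring

theorem groundSpace_eq_top (hA : A.IsHermitian) (h0 : ActsOn A ∅) : groundSpace A = ⊤ := by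
  obtain ⟨h, hh⟩ := h0
  have h1 : ∀ v : QubitSpace n, Matrix.toEuclideanLin A v =
      h (fun _ => false) (fun _ => false) • v := by
    intro v
    ext x
    rw [mulVec_eq_sum_overwrite hh, Fintype.sum_eq_single (fun _ => false)]
    · rw [PiLp.smul_apply, smul_eq_mul]
      have hx : HyperNetwork.overwrite x (fun _ : (∅ : Finset (Fin n)) => false) = x := by
        funext i
        simp [HyperNetwork.overwrite]
      rw [hx]
      congr 2
      exact Subsingleton.elim _ _
    · intro z hz
      exact absurd (Subsingleton.elim _ _) hz
  obtain ⟨i, hi⟩ := exists_eigenvalues_eq_groundEnergy hA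
  have h2 := toEuclideanLin_eigenvectorBasis hA i
  rw [h1, hi] at h2
  have h3 := smul_left_injective ℂ (hA.eigenvectorBasis.orthonormal.ne_zero i) h2
  refine eq_top_iff.2 fun v _ => mem_groundSpace.2 ?_
  rw [h1, h3]

end gates

/-! ### Lower bound on the overlap with the uniform superposition -/

section overlap

variable {n : ℕ} {A : QubitMatrix n}

theorem inner_toEuclideanLin_eq_sum (v : QubitSpace n) :
    inner ℂ v (Matrix.toEuclideanLin A v) =
      ∑ x, ∑ y, A x y * (v y * (starRingEnd ℂ) (v x)) := by
  have h1 : ∀ x, Matrix.toEuclideanLin A v x = ∑ y, A x y * v y := fun _ => rfl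
  rw [PiLp.inner_apply]
  refine Finset.sum_congr rfl fun x _ => ?_
  rw [RCLike.inner_apply, h1, Finset.sum_mul]
  exact Finset.sum_congr rfl fun y _ => mul_assoc _ _ _

/-- The ground space of a stoquastic matrix is closed under taking entrywise absolute values. -/
theorem abs_mem_groundSpace (hA : A.IsHermitian) (hst : IsStoquasticMatrix A) {ψ : QubitSpace n}
    (hψ : ψ ∈ groundSpace A) :
    (WithLp.toLp 2 fun x => ((‖ψ x‖ : ℝ) : ℂ) : QubitSpace n) ∈ groundSpace A := by
  set φ : QubitSpace n := WithLp.toLp 2 fun x => ((‖ψ x‖ : ℝ) : ℂ) with hφ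
  have hn : ‖φ‖ ^ 2 = ‖ψ‖ ^ 2 := by
    simp [EuclideanSpace.norm_sq_eq, hφ]
  refine mem_groundSpace_of_re_inner_le hA ?_
  have h1 : (inner ℂ ψ (Matrix.toEuclideanLin A ψ)).re = groundEnergy A * ‖φ‖ ^ 2 := by
    rw [mem_groundSpace.1 hψ, inner_smul_right, inner_self_eq_norm_sq_to_K, hn,
      Complex.re_ofReal_mul]
    congr 1
    norm_cast
  rw [← h1, inner_toEuclideanLin_eq_sum, inner_toEuclideanLin_eq_sum]
  simp only [Complex.re_sum]
  refine Finset.sum_le_sum fun x _ => Finset.sum_le_sum fun y _ => ?_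
  rw [Complex.mul_re (A x y), Complex.mul_re (A x y), (hst x y).1, zero_mul, zero_mul, sub_zero,
    sub_zero]
  have h2 : (φ y * (starRingEnd ℂ) (φ x)).re = ‖ψ y * (starRingEnd ℂ) (ψ x)‖ := by
    simp [hφ]
  rw [h2]
  -- Diagonal contributions agree; off the diagonal the coefficient is non-positive, so removing
  -- phases can only lower the energy.
  by_cases hxy : x = y
  · subst hxy
    rw [Complex.mul_conj, Complex.norm_real, Complex.ofReal_re,
      Real.norm_of_nonneg (Complex.normSq_nonneg _)]
  · exact mul_le_mul_of_nonpos_left (Complex.re_le_norm _) ((hst x y).2 hxy)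

theorem norm_plusState (n : ℕ) : ‖plusState n‖ = 1 := by
  have h : ‖plusState n‖ ^ 2 = 1 := by
    rw [EuclideanSpace.norm_sq_eq]
    simp [plusState, abs_of_nonneg]
  exact (pow_eq_one_iff_of_nonneg (norm_nonneg _) two_ne_zero).1 h

theorem plusOverlap_eq_norm (A : QubitMatrix n) :
    plusOverlap A = ‖(groundSpace A).starProjection (plusState n)‖ := by
  have h : (inner ℂ (plusState n) ((groundSpace A).starProjection (plusState n))).re =
      ‖(groundSpace A).starProjection (plusState n)‖ ^ 2 := by
    have := (groundSpace A).re_inner_starProjection_eq_normSq (plusState n)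
    rw [(groundSpace A).inner_starProjection_left_eq_right] at this
    exact this
  rw [plusOverlap, h, Real.sqrt_sq (norm_nonneg _)]

theorem plusOverlap_le_one (A : QubitMatrix n) : plusOverlap A ≤ 1 := by
  rw [plusOverlap_eq_norm, ← norm_plusState n]
  exact (groundSpace A).norm_starProjection_apply_le _

/-- For `φ = |ψ|` in the ground space, `⟨φ|+⟩` is `2^(-n/2)` times the ℓ¹ norm of `ψ`, which
dominates its ℓ² norm, while Cauchy–Schwarz bounds `⟨φ|+⟩` by `‖ψ‖ η`. -/
theorem inv_sqrt_le_plusOverlap (hA : A.IsHermitian) (hst : IsStoquasticMatrix A)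
    {ψ : QubitSpace n} (hψ : ψ ∈ groundSpace A) (h0 : ψ ≠ 0) :
    (Real.sqrt (2 ^ n))⁻¹ ≤ plusOverlap A := by
  have hφ := abs_mem_groundSpace hA hst hψ
  set φ : QubitSpace n := WithLp.toLp 2 fun x => ((‖ψ x‖ : ℝ) : ℂ) with hφd
  have hn : ‖φ‖ = ‖ψ‖ := by
    simp [EuclideanSpace.norm_eq, hφd]
  have h1 : inner ℂ φ (plusState n) =
      inner ℂ φ ((groundSpace A).starProjection (plusState n)) := by
    rw [← (groundSpace A).inner_starProjection_left_eq_right,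
      (groundSpace A).starProjection_eq_self_iff.2 hφ]
  have h2 : inner ℂ φ (plusState n) = (((Real.sqrt (2 ^ n))⁻¹ * ∑ x, ‖ψ x‖ : ℝ) : ℂ) := by
    rw [PiLp.inner_apply, Finset.mul_sum]
    push_cast
    exact Finset.sum_congr rfl fun x _ => by simp [plusState, hφd]
  have h3 : ‖ψ‖ ≤ ∑ x, ‖ψ x‖ := by
    refine abs_le_of_sq_le_sq' ?_ (Finset.sum_nonneg fun _ _ => norm_nonneg _) |>.2
    rw [EuclideanSpace.norm_sq_eq]
    rw [sq (∑ x, ‖ψ x‖), Finset.sum_mul]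
    refine Finset.sum_le_sum fun x _ => ?_
    rw [sq]
    exact mul_le_mul_of_nonneg_left (Finset.single_le_sum (f := fun x => ‖ψ x‖)
      (fun _ _ => norm_nonneg _) (Finset.mem_univ x)) (norm_nonneg _)
  have h4 : (Real.sqrt (2 ^ n))⁻¹ * ∑ x, ‖ψ x‖ ≤ ‖ψ‖ * plusOverlap A := by
    rw [plusOverlap_eq_norm, ← hn]
    refine le_trans ?_ (norm_inner_le_norm (𝕜 := ℂ) φ _)
    rw [← h1, h2, Complex.norm_real]
    exact le_abs_self _
  have h5 : 0 < ‖ψ‖ := norm_pos_iff.2 h0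
  have h6 : (Real.sqrt (2 ^ n))⁻¹ * ‖ψ‖ ≤ plusOverlap A * ‖ψ‖ := by
    refine (mul_le_mul_of_nonneg_left h3 (by positivity)).trans ?_
    rwa [mul_comm (plusOverlap A)]
  exact le_of_mul_le_mul_right h6 h5

theorem log_inv_plusOverlap_le (h : (Real.sqrt (2 ^ n))⁻¹ ≤ plusOverlap A) :
    Real.log (plusOverlap A)⁻¹ ≤ (n : ℝ) / 2 * Real.log 2 := by
  have h0 : 0 < (Real.sqrt (2 ^ n))⁻¹ := by positivity
  have h1 := Real.log_le_log h0 h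
  rw [Real.log_inv, Real.log_sqrt (by positivity), Real.log_pow] at h1
  rw [Real.log_inv]
  linarith

end overlap

/-! ### Consequences of frustration freeness -/

namespace LocalHamiltonian

variable {n k L : ℕ} (H : LocalHamiltonian n k L)

theorem total_isHermitian : H.total.IsHermitian := by
  rw [Matrix.IsHermitian, total, Matrix.conjTranspose_sum]
  exact Finset.sum_congr rfl fun a _ => H.hermitian a

theorem total_isStoquasticMatrix (hH : H.IsStoquastic) : IsStoquasticMatrix H.total := by
  refine H.total_isHermitian.isStoquasticMatrix fun x y hxy => ?_
  rw [total, Matrix.sum_apply, Complex.im_sum, Complex.re_sum]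
  exact ⟨Finset.sum_eq_zero fun a _ => (hH a x y hxy).1,
    Finset.sum_nonpos fun a _ => (hH a x y hxy).2⟩

theorem toEuclideanLin_total (v : QubitSpace n) :
    Matrix.toEuclideanLin H.total v = ∑ a, Matrix.toEuclideanLin (H.term a) v := by
  rw [total, map_sum, LinearMap.sum_apply]

variable {H}

theorem IsFrustrationFree.groundEnergy_total (hH : H.IsFrustrationFree) :
    groundEnergy H.total = ∑ a, groundEnergy (H.term a) := by
  obtain ⟨ψ, h0, h1, h2⟩ := hH
  have h3 := mem_groundSpace.1 h1
  rw [toEuclideanLin_total, Finset.sum_congr rfl fun a _ => mem_groundSpace.1 (h2 a),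
    ← Finset.sum_smul] at h3
  have := smul_left_injective ℂ h0 h3
  exact_mod_cast this.symm

theorem IsFrustrationFree.sum_re_inner_excitation (hH : H.IsFrustrationFree) (τ : ℝ)
    (v : QubitSpace n) : ∑ a, (inner ℂ v (excitation (H.term a) τ v)).re =
      τ * ((inner ℂ v (Matrix.toEuclideanLin H.total v)).re - groundEnergy H.total * ‖v‖ ^ 2) := by
  simp only [re_inner_excitation, ← Finset.mul_sum, Finset.sum_sub_distrib]
  rw [hH.groundEnergy_total, toEuclideanLin_total, inner_sum, Complex.re_sum, Finset.sum_mul]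

/-- The term energies above their minima are non-negative and sum to the total energy above its
minimum, which vanishes; so each vanishes. -/
theorem IsFrustrationFree.groundSpace_total_le (hH : H.IsFrustrationFree) (a : Fin L) :
    groundSpace H.total ≤ groundSpace (H.term a) := by
  intro v hv
  have h1 := hH.sum_re_inner_excitation 1 v
  have h2 : (inner ℂ v (Matrix.toEuclideanLin H.total v)).re = groundEnergy H.total * ‖v‖ ^ 2 := by
    rw [mem_groundSpace.1 hv, inner_smul_right, inner_self_eq_norm_sq_to_K,
      Complex.re_ofReal_mul]
    congr 1
    norm_cast
  rw [h2, sub_self, mul_zero] at h1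
  have h3 : ∀ b ∈ Finset.univ, 0 ≤ (inner ℂ v (excitation (H.term b) 1 v)).re := by
    intro b _
    rw [re_inner_excitation, one_mul]
    exact sub_nonneg.2 (groundEnergy_mul_le (H.hermitian b) v)
  have h4 := (Finset.sum_eq_zero_iff_of_nonneg h3).1 h1 a (Finset.mem_univ a)
  rw [re_inner_excitation, one_mul] at h4
  exact mem_groundSpace_of_re_inner_le (H.hermitian a) (sub_eq_zero.1 h4).le

end LocalHamiltonian

/-! ### From damped vectors to networks and distributions -/

section representation

variable {n : ℕ}

theorem exists_hyperNetwork_dampSeq {B : ℕ → QubitSpace n →ₗ[ℂ] QubitSpace n} {k : ℕ}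
    (hB : ∀ j, ∃ S : Finset (Fin n), S.Nonempty ∧ S.card ≤ k ∧
      ∃ w : (S → Bool) → (S → Bool) → ℝ, (∀ u z, 0 ≤ w u z) ∧
        ∀ (v : QubitSpace n) (f : (Fin n → Bool) → ℝ), (∀ x, v x = (f x : ℂ)) →
          ∀ x, (v - B j v) x =
            ((∑ z, w (fun i => x i) z * f (HyperNetwork.overwrite x z) : ℝ) : ℂ))
    {s : ℝ} {φ : QubitSpace n} (hφ : ∀ x, φ x = (s : ℂ)) (T : ℕ) :
    ∃ N : HyperNetwork n, Fintype.card N.Index = T ∧ Fintype.card N.Hidden ≤ k * T ∧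
      (∀ t, (N.edge t).card ≤ 2 * k) ∧ (∀ i, N.degree (Sum.inl i) ≤ 1) ∧
      (∀ j, N.degree (Sum.inr j) ≤ 2) ∧
      ∀ x, dampSeq B φ T x = ((s * N.output x : ℝ) : ℂ) := by
  induction T with
  | zero =>
    refine ⟨HyperNetwork.empty n, Fintype.card_empty, Fintype.card_empty.le, fun t => t.elim,
      fun i => (Finset.card_le_univ _).trans (Fintype.card_empty.le.trans zero_le_one),
      fun j => j.elim, fun x => ?_⟩
    rw [HyperNetwork.empty_output, mul_one]
    exact hφ x
  | succ T ih =>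
    obtain ⟨N, h1, h2, h3, h4, h5, h6⟩ := ih
    obtain ⟨S, hS, hSk, w, hw, hwB⟩ := hB T
    refine ⟨N.applyGate S hS w hw, ?_, ?_, N.applyGate_card_edge hS hw hSk h3,
      N.applyGate_degree_visible hS hw h4, N.applyGate_degree_hidden hS hw h4 h5, fun x => ?_⟩
    · rw [N.applyGate_card_index hS hw, h1]
    · rw [N.applyGate_card_hidden hS hw, Nat.mul_succ]
      exact Nat.add_le_add h2 hSk
    · rw [dampSeq, hwB _ _ h6, N.applyGate_output hS hw, Finset.mul_sum]
      exact congrArg _ (Finset.sum_congr rfl fun z _ => by ring)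

theorem square_output_div_sum (N : HyperNetwork n) {s : ℝ} (hs : s ≠ 0) {u : QubitSpace n}
    (hu : ∀ x, u x = ((s * N.output x : ℝ) : ℂ)) (x : Fin n → Bool) :
    N.square.output x / ∑ y, N.square.output y = ‖u x‖ ^ 2 / ‖u‖ ^ 2 := by
  have h : ∀ y, ‖u y‖ ^ 2 = s ^ 2 * N.square.output y := by
    intro y
    rw [hu, Complex.norm_real, Real.norm_eq_abs, sq_abs, N.square_output]
    ring
  rw [EuclideanSpace.norm_sq_eq]
  simp only [h, ← Finset.mul_sum]
  rw [mul_div_mul_left _ _ (pow_ne_zero 2 hs)]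

theorem sum_square_output_pos (N : HyperNetwork n) {s : ℝ} {u : QubitSpace n}
    (hu : ∀ x, u x = ((s * N.output x : ℝ) : ℂ)) (hu0 : u ≠ 0) :
    0 < ∑ x, N.square.output x := by
  have h0 : ∀ x ∈ Finset.univ, 0 ≤ N.square.output x := fun x _ => by
    rw [N.square_output]
    exact sq_nonneg _
  obtain ⟨x, hx⟩ : ∃ x, u x ≠ 0 := by
    by_contra! h
    exact hu0 (PiLp.ext h)
  refine Finset.sum_pos' h0 ⟨x, Finset.mem_univ x, (h0 x (Finset.mem_univ x)).lt_of_ne' ?_⟩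
  rw [N.square_output]
  refine pow_ne_zero 2 fun h => hx ?_
  rw [hu, h, mul_zero, Complex.ofReal_zero]

theorem plusGroundState_eq (A : QubitMatrix n) : plusGroundState A =
    ((‖(groundSpace A).starProjection (plusState n)‖⁻¹ : ℝ) : ℂ) •
      (groundSpace A).starProjection (plusState n) := by
  rw [plusGroundState, plusOverlap_eq_norm]

theorem re_inner_plusState_starProjection (A : QubitMatrix n) :
    (inner ℂ (plusState n) ((groundSpace A).starProjection (plusState n))).re =
      ‖(groundSpace A).starProjection (plusState n)‖ ^ 2 := by
  have := (groundSpace A).re_inner_starProjection_eq_normSq (plusState n)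
  rw [(groundSpace A).inner_starProjection_left_eq_right] at this
  exact this

/-- The Hyper Boltzmann Machine without hyperedges is good enough if the ground state is close
to the uniform superposition. -/
theorem exists_hbm_of_plusOverlap_near_one {A : QubitMatrix n} (hη : 0 < plusOverlap A) {ε : ℝ}
    (hε : 0 < ε) (h : 2 - 2 * plusOverlap A ≤ ε ^ 2) :
    ∃ B : HBM n 0, B.edges = ∅ ∧ B.RepresentsInDistribution (plusGroundState A) ε := by
  refine ⟨⟨∅, fun _ _ => 0⟩, rfl, ?_⟩
  rw [plusOverlap_eq_norm] at hη h
  have h1 := total_variation_normalize_le (u := plusState n)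
    (norm_pos_iff.1 (by rw [norm_plusState]; exact one_pos)) (norm_pos_iff.1 hη)
    (re_inner_plusState_starProjection A)
  rw [← plusGroundState_eq] at h1
  have h2 : ∀ x, ‖plusState n x‖ ^ 2 / ‖plusState n‖ ^ 2 = 1 / (2 ^ n : ℝ) := by
    intro x
    rw [norm_plusState]
    simp [plusState, abs_of_nonneg]
  rw [norm_plusState, div_one] at h1
  rw [HBM.RepresentsInDistribution]
  refine (abs_le_of_sq_le_sq' ?_ hε.le).2
  refine le_trans (le_of_eq ?_) (h1.trans h)
  rw [← norm_plusState n]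
  simp only [h2]
  simp [HBM.output, HBM.totalEnergy]

end representation

/-! ### Number of rounds and conclusion -/

/-- Otherwise `η ε ≥ exp(-1/4) ≥ 3/4`, so both factors are at least 3/4 and `2 - 2η ≤ 1/2 < 9/16 ≤
ε²`. The bound lets rounding up the number of rounds be absorbed in the constant. -/
theorem quarter_lt_log_inv_mul_inv {η ε : ℝ} (hη : 0 < η) (hη1 : η ≤ 1) (hε : 0 < ε)
    (hε1 : ε ≤ 1) (h : ε ^ 2 < 2 - 2 * η) : 1 / 4 < Real.log (η⁻¹ * ε⁻¹) := by
  rw [← mul_inv, Real.log_inv]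
  by_contra! hlog
  have h1 : Real.exp (-(1 / 4)) ≤ η * ε := by
    rw [← Real.le_log_iff_exp_le (by positivity)]
    linarith
  have h2 := Real.add_one_le_exp (-(1 / 4 : ℝ))
  have h3 : 3 / 4 ≤ η := by nlinarith
  have h4 : 3 / 4 ≤ ε := by nlinarith
  nlinarith

theorem two_mul_exp_lt {η ε δ q : ℝ} (hη : 0 < η) (hε : 0 < ε) (hδ : δ = Real.log (η⁻¹ * ε⁻¹))
    (h : 1 / 4 < δ) (hq : 6 * δ ≤ q) : 2 * Real.exp (-q) < (η * ε) ^ 2 := by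
  have h1 : η * ε = Real.exp (-δ) := by
    rw [hδ, ← mul_inv, Real.log_inv, neg_neg, Real.exp_log (by positivity)]
  have h2 : Real.exp (-q) ≤ Real.exp (-(6 * δ)) := Real.exp_le_exp.2 (by linarith)
  have h3 : (η * ε) ^ 2 = Real.exp (4 * δ) * Real.exp (-(6 * δ)) := by
    rw [h1, ← Real.exp_nat_mul, ← Real.exp_add]
    congr 1
    push_cast
    ring
  have h4 := Real.add_one_le_exp (4 * δ)
  rw [h3]
  nlinarith [Real.exp_pos (-(6 * δ))]

namespace LocalHamiltonian

variable {n k L : ℕ} {H : LocalHamiltonian n k L} {Δ J : ℝ}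

/-- Gates need a non-empty support. An empty one is enlarged by one qubit, unless `n = 0` or `k =
0`; then `H` is scalar and the overlap is 1. -/
theorem exists_nonempty_support (hη : plusOverlap H.total < 1) (a : Fin L) :
    ∃ S : Finset (Fin n), S.Nonempty ∧ S.card ≤ k ∧ ActsOn (H.term a) S := by
  obtain ⟨S, hSk, hS⟩ := H.isLocal a
  by_cases hS0 : S.Nonempty
  · exact ⟨S, hS0, hSk, hS⟩
  obtain ⟨i, hk⟩ : ∃ _ : Fin n, 1 ≤ k := by
    by_contra! h
    have h0 : ∀ b, ActsOn (H.term b) ∅ := by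
      intro b
      obtain ⟨S', hSk', hS'⟩ := H.isLocal b
      have : S' = ∅ := by
        by_contra! h'
        obtain ⟨i, hi⟩ := h'
        have := h i
        have := Finset.card_pos.2 ⟨i, hi⟩
        omega
      exact this ▸ hS'
    have h1 := groundSpace_eq_top H.total_isHermitian (ActsOn.sum h0)
    rw [plusOverlap_eq_norm, h1, Submodule.starProjection_top] at hη
    simp [norm_plusState] at hη
  rw [Finset.not_nonempty_iff_eq_empty] at hS0
  subst hS0
  exact ⟨{i}, Finset.singleton_nonempty i, by simpa using hk, hS.mono (Finset.empty_subset _)⟩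

theorem gap_mul_le_sum_excitation (hff : H.IsFrustrationFree) (hgap : HasEnergyGap H.total Δ)
    {τ : ℝ} (hτ : 0 ≤ τ) {v : QubitSpace n} (hv : v ∈ (groundSpace H.total)ᗮ) :
    τ * Δ * ‖v‖ ^ 2 ≤ ∑ a, (inner ℂ v (excitation (H.term a) τ v)).re := by
  rw [hff.sum_re_inner_excitation, mul_assoc]
  have := gap_mul_le H.total_isHermitian hgap hv
  exact mul_le_mul_of_nonneg_left (by linarith) hτ

theorem gap_le (hff : H.IsFrustrationFree) (hgap : HasEnergyGap H.total Δ)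
    (hJ : ∀ a, opNorm (H.term a) ≤ J) {v : QubitSpace n} (hv : v ∈ (groundSpace H.total)ᗮ)
    (hv0 : v ≠ 0) : Δ ≤ 2 * L * J := by
  have h1 := gap_mul_le_sum_excitation hff hgap zero_le_one hv
  have h2 : ∀ a ∈ Finset.univ, (inner ℂ v (excitation (H.term a) 1 v)).re ≤ 2 * J * ‖v‖ ^ 2 := by
    intro a _
    refine (re_inner_le_norm (𝕜 := ℂ) _ _).trans ?_
    have := norm_excitation_le (H.hermitian a) zero_le_one (hJ a) v
    nlinarith [norm_nonneg v]
  have h3 := h1.trans (Finset.sum_le_sum h2)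
  rw [Finset.sum_const, Finset.card_univ, Fintype.card_fin, nsmul_eq_mul, one_mul] at h3
  have h4 : 0 < ‖v‖ ^ 2 := pow_pos (norm_pos_iff.2 hv0) 2
  refine le_of_mul_le_mul_right (h3.trans (le_of_eq ?_)) h4
  ring

/-- `N` rounds of all the gates `1 - τ (Hₐ - Eₐ)` bring the uniform superposition close to the
ground space. -/
theorem exists_hbm_of_rounds (hst : H.IsStoquastic) (hff : H.IsFrustrationFree)
    (hgap : HasEnergyGap H.total Δ) (hJ : ∀ a, opNorm (H.term a) ≤ J) (hL : 0 < L)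
    (hJ0 : 0 < J) (hη0 : 0 < plusOverlap H.total) (hη : plusOverlap H.total < 1) {ε : ℝ}
    (hε : 0 < ε) (N : ℕ)
    (hN : 2 * Real.exp (-(N * ((2 * J)⁻¹ * Δ / (4 * L ^ 2)))) < (plusOverlap H.total * ε) ^ 2) :
    ∃ (m : ℕ) (B : HBM n m), B.IsLocal (2 * k) ∧ m ≤ 2 * (k * (N * L)) ∧
      B.edges.card = 2 * (N * L) ∧ (∀ v, B.degree v ≤ 2) ∧
      B.RepresentsInDistribution (plusGroundState H.total) ε := by
  set K := groundSpace H.total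
  set τ := (2 * J)⁻¹ with hτd
  have hτ : 0 ≤ τ := by positivity
  have hJτ : 2 * J * τ ≤ 1 := (mul_inv_cancel₀ (by positivity)).le
  set A : ℕ → QubitSpace n →ₗ[ℂ] QubitSpace n :=
    fun j => excitation (H.term ⟨j % L, Nat.mod_lt j hL⟩) τ with hA
  have hAd : ∀ j, IsDamping (A j) := fun j =>
    excitation_isDamping (H.hermitian _) hτ (hJ _) hJτ
  set v := K.starProjection (plusState n) with hv
  set w := plusState n - v with hw
  have hvK : v ∈ K := K.starProjection_apply_mem _
  have hwK : w ∈ Kᗮ := K.sub_starProjection_mem_orthogonal _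
  have hvn : plusOverlap H.total = ‖v‖ := plusOverlap_eq_norm _
  rw [hvn] at hN hη0
  have hAK : ∀ j, ∀ u ∈ Kᗮ, A j u ∈ Kᗮ := fun j u _ =>
    excitation_mem_orthogonal (H.hermitian _) τ (hff.groundSpace_total_le _) u
  have hwn : ‖w‖ ^ 2 ≤ 1 := by
    have h := K.norm_sq_eq_add_norm_sq_starProjection (plusState n)
    rw [norm_plusState, Submodule.starProjection_orthogonal_val] at h
    have : 0 ≤ ‖v‖ ^ 2 := sq_nonneg _
    linarith
  set T := N * L
  set w' := dampSeq A w T with hw'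
  have hw'K : w' ∈ Kᗮ := dampSeq_mem hAK hwK T
  have hw'n : ‖w'‖ ^ 2 ≤ Real.exp (-(N * (τ * Δ / (4 * L ^ 2)))) := by
    refine (norm_dampSeq_sq_le_exp hAd hAK (γ := τ * Δ) hL (fun s φ hφ => ?_) hwK N).trans
      (mul_le_of_le_one_right (Real.exp_pos _).le hwn)
    refine (gap_mul_le_sum_excitation hff hgap hτ hφ).trans (le_of_eq ?_)
    rw [Finset.sum_range]
    refine Finset.sum_congr rfl fun a _ => ?_
    have : (s * L + (a : ℕ)) % L = a := by
      rw [Nat.mul_add_mod', Nat.mod_eq_of_lt a.2]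
    simp only [hA, this]
  set u := dampSeq A (plusState n) T with hu
  have huv : u = v + w' := by
    have h1 : plusState n = v + w := (add_sub_cancel _ _).symm
    rw [hu, h1, dampSeq_add, dampSeq_eq_self fun j =>
      excitation_eq_zero (hff.groundSpace_total_le _ hvK) τ]
  have hw'v : inner ℂ w' v = 0 := K.inner_left_of_mem_orthogonal hvK hw'K
  have huv' : (inner ℂ u v).re = ‖v‖ ^ 2 := by
    rw [huv, inner_add_left, hw'v, add_zero]
    exact inner_self_eq_norm_sq (𝕜 := ℂ) v
  have hv0 : v ≠ 0 := norm_pos_iff.1 hη0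
  have hu0 : u ≠ 0 := by
    intro h
    rw [h, inner_zero_left] at huv'
    exact (pow_pos hη0 2).ne huv'
  have hun : ‖u‖ ^ 2 = ‖v‖ ^ 2 + ‖w'‖ ^ 2 := by
    have := norm_add_sq (𝕜 := ℂ) w' v
    rw [hw'v, add_comm w' v, ← huv] at this
    simp at this
    linarith
  have hun0 : 0 < ‖u‖ := norm_pos_iff.2 hu0
  have htv := total_variation_normalize_le hu0 hv0 huv'
  -- With `r = ‖v‖ / ‖u‖ ≤ 1`, one has `2 - 2r ≤ 2 - 2r² = 2‖w'‖² / ‖u‖²`, and `hN` bounds this by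
  -- `ε²` because `‖v‖ ≤ ‖u‖`.
  have hlt : 2 - 2 * (‖v‖ / ‖u‖) < ε ^ 2 := by
    have h1 : ‖v‖ ≤ ‖u‖ := le_of_sq_le_sq (by nlinarith [sq_nonneg ‖w'‖]) hun0.le
    have h2 : ‖v‖ / ‖u‖ ≤ 1 := (div_le_one hun0).2 h1
    have h3 : 0 ≤ ‖v‖ / ‖u‖ := by positivity
    have h4 : (‖v‖ / ‖u‖) ^ 2 * ‖u‖ ^ 2 = ‖v‖ ^ 2 := by
      rw [← mul_pow, div_mul_cancel₀ _ hun0.ne']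
    have h5 : (2 - 2 * (‖v‖ / ‖u‖) ^ 2) * ‖u‖ ^ 2 < ε ^ 2 * ‖u‖ ^ 2 := by
      have h6 : ε ^ 2 * ‖v‖ ^ 2 ≤ ε ^ 2 * ‖u‖ ^ 2 := by gcongr
      rw [mul_pow] at hN
      nlinarith
    have h6 := lt_of_mul_lt_mul_right h5 (sq_nonneg _)
    nlinarith
  obtain ⟨M, h1, h2, h3, h4, h5, h6⟩ := exists_hyperNetwork_dampSeq (B := A) (k := k)
    (fun j => by
      obtain ⟨S, hS, hSk, hact⟩ := exists_nonempty_support hη ⟨j % L, Nat.mod_lt j hL⟩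
      exact ⟨S, hS, hSk, exists_gate_weight ((H.hermitian _).isStoquasticMatrix (hst _)) hact hτ
        (hAd j)⟩)
    (φ := plusState n) (fun _ => rfl) T
  have hs : (Real.sqrt (2 ^ n))⁻¹ ≠ 0 := by positivity
  have hM : (1 / 2 : ℝ) * ∑ x, |M.square.output x / (∑ y, M.square.output y) -
      ‖plusGroundState H.total x‖ ^ 2| < ε := by
    simp only [square_output_div_sum M hs h6, plusGroundState_eq]
    exact lt_of_pow_lt_pow_left₀ 2 hε.le (htv.trans_lt hlt)
  obtain ⟨B, hB1, hB2, hB3, hB4⟩ := M.square.exists_hbm _ (sum_square_output_pos M h6 hu0) hM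
    (M.square_card_edge h3) (M.square_degree h4 h5)
  refine ⟨_, B, hB1, ?_, ?_, hB3, hB4⟩
  · rw [M.square_card_hidden]
    exact Nat.mul_le_mul_left 2 h2
  · rw [hB2, M.square_card_index, h1]

end LocalHamiltonian

theorem mainTheorem4 :
    ∃ C : ℝ, 0 < C ∧
      ∀ (n k L : ℕ) (H : LocalHamiltonian n k L) (Δ J : ℝ),
        H.IsStoquastic → H.IsFrustrationFree → HasEnergyGap H.total Δ →
        (∀ a, opNorm (H.term a) ≤ J) →
        (0 < plusOverlap H.total ∧
          Real.log (plusOverlap H.total)⁻¹ ≤ (n : ℝ) / 2 * Real.log 2) ∧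
        ∀ ε : ℝ, 0 < ε → ε ≤ 1 →
          ∃ (m : ℕ) (B : HBM n m),
            B.IsLocal (2 * k) ∧
            (m : ℝ) ≤ C * ((k : ℝ) * (L : ℝ) ^ 3 * J * Δ⁻¹ *
              Real.log ((plusOverlap H.total)⁻¹ * ε⁻¹)) ∧
            (B.edges.card : ℝ) ≤ C * ((L : ℝ) ^ 3 * J * Δ⁻¹ *
              Real.log ((plusOverlap H.total)⁻¹ * ε⁻¹)) ∧
            (∀ v, B.degree v ≤ 2) ∧
            B.RepresentsInDistribution (plusGroundState H.total) ε := by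
  refine ⟨112, by norm_num, fun n k L H Δ J hst hff hgap hJ => ?_⟩
  have hle : (Real.sqrt (2 ^ n))⁻¹ ≤ plusOverlap H.total := by
    obtain ⟨ψ, hψ0, hψ, -⟩ := id hff
    exact inv_sqrt_le_plusOverlap H.total_isHermitian (H.total_isStoquasticMatrix hst) hψ hψ0
  have hη0 : 0 < plusOverlap H.total := lt_of_lt_of_le (by positivity) hle
  refine ⟨⟨hη0, log_inv_plusOverlap_le hle⟩, fun ε hε hε1 => ?_⟩
  have hη1 := plusOverlap_le_one H.total
  have hΔ := hgap.1
  set η := plusOverlap H.total with hηd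
  -- The logarithm may vanish here (for `η = ε = 1`), so no hidden nodes or hyperedges can be
  -- afforded in this case.
  by_cases hsmall : 2 - 2 * η ≤ ε ^ 2
  · obtain ⟨B, hB, hrep⟩ := exists_hbm_of_plusOverlap_near_one hη0 hε hsmall
    have hlog : 0 ≤ Real.log (η⁻¹ * ε⁻¹) :=
      Real.log_nonneg (one_le_mul_of_one_le_of_one_le ((one_le_inv₀ hη0).2 hη1)
        ((one_le_inv₀ hε).2 hε1))
    have hLJ : 0 ≤ (L : ℝ) ^ 3 * J := by
      rcases Nat.eq_zero_or_pos L with rfl | hL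
      · simp
      · have : 0 ≤ J := (norm_nonneg _).trans (hJ ⟨0, hL⟩)
        positivity
    have hΔi : 0 ≤ Δ⁻¹ := inv_nonneg.2 hΔ.le
    refine ⟨0, B, fun e he => by simp [hB] at he, ?_, ?_, fun v => by simp [HBM.degree, hB], hrep⟩
    · rw [Nat.cast_zero, mul_assoc (k : ℝ)]
      positivity
    · rw [hB, Finset.card_empty, Nat.cast_zero]
      positivity
  · rw [not_le] at hsmall
    have hδ := quarter_lt_log_inv_mul_inv hη0 hη1 hε hε1 hsmall
    set δ := Real.log (η⁻¹ * ε⁻¹) with hδd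
    have hη : η < 1 := by nlinarith [sq_nonneg ε]
    have hw0 : plusState n - (groundSpace H.total).starProjection (plusState n) ≠ 0 := by
      intro h
      rw [hηd, plusOverlap_eq_norm, ← sub_eq_zero.1 h, norm_plusState] at hη
      exact lt_irrefl _ hη
    have hΔle := H.gap_le hff hgap hJ
      ((groundSpace H.total).sub_starProjection_mem_orthogonal _) hw0
    have hL : 0 < L := by
      rcases Nat.eq_zero_or_pos L with rfl | hL
      · simp at hΔle
        linarith
      · exact hL
    have hL1 : (1 : ℝ) ≤ L := by exact_mod_cast hL
    have hJ0 : 0 < J := by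
      by_contra! hJ0
      nlinarith
    set q := J * (L : ℝ) ^ 2 * Δ⁻¹ * δ with hq
    -- From `Δ ≤ 2LJ`, `L ≥ 1` and `δ > 1/4`. It gives `48q + 1 ≤ 56q`; two copies of the network
    -- then yield 112.
    have hq1 : 1 / 8 ≤ q := by
      have h1 : 1 / 2 ≤ J * (L : ℝ) * Δ⁻¹ := by
        rw [← div_eq_mul_inv, le_div_iff₀ hΔ]
        linarith
      have h2 : 1 / 2 ≤ J * (L : ℝ) * Δ⁻¹ * L := by nlinarith
      have h3 : q = J * (L : ℝ) * Δ⁻¹ * L * δ := by rw [hq]; ring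
      rw [h3]
      nlinarith
    have hN1 : 48 * q ≤ (⌈48 * q⌉₊ : ℝ) := Nat.le_ceil _
    have hN2 : (⌈48 * q⌉₊ : ℝ) < 48 * q + 1 := Nat.ceil_lt_add_one (by linarith)
    set N := ⌈48 * q⌉₊
    -- The factor 48 is 6 times the 8 in the decay rate `Δ / (8 J L²)` per round.
    have hexp : 6 * δ ≤ N * ((2 * J)⁻¹ * Δ / (4 * (L : ℝ) ^ 2)) := by
      have h1 : 48 * q * ((2 * J)⁻¹ * Δ / (4 * (L : ℝ) ^ 2)) = 6 * δ := by
        rw [hq]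
        field_simp
        ring
      rw [← h1]
      gcongr
    obtain ⟨m, B, h1, h2, h3, h4, h5⟩ := H.exists_hbm_of_rounds hst hff hgap hJ hL hJ0 hη0 hη hε N
      (two_mul_exp_lt hη0 hε hδd hδ hexp)
    have hNq : (N : ℝ) ≤ 56 * q := by linarith
    have hNL : 2 * ((N : ℝ) * L) ≤ 112 * ((L : ℝ) ^ 3 * J * Δ⁻¹ * δ) := by
      have h6 : (L : ℝ) ^ 3 * J * Δ⁻¹ * δ = q * L := by rw [hq]; ring
      rw [h6]
      nlinarith
    refine ⟨m, B, h1, ?_, ?_, h4, h5⟩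
    · have h6 : (m : ℝ) ≤ 2 * (k * (N * L)) := by exact_mod_cast h2
      refine h6.trans ?_
      calc (2 * (k * (N * L)) : ℝ) = k * (2 * (N * L)) := by ring
        _ ≤ k * (112 * ((L : ℝ) ^ 3 * J * Δ⁻¹ * δ)) := by gcongr
        _ = _ := by ring
    · rw [h3]
      exact_mod_cast hNL
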